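/- Let $N\ge 1$ and let $k,m,n$ be integers with $k>\frac N2$, $n>\frac N2+1$ and $2m\ge k+n+3$. Put $J=2m+2+k$, $d=2^{[(N+1)/2]}$ (with $[\cdot]$ the integer part) and $\langle x\rangle=(1+|x|^2)^{1/2}$ for $x\in\mathbb R^N$. Let $\mathcal X_d$ be the space of all $u\in H^J(\mathbb R^N,\mathbb C^d)$ such that $\langle x\rangle^nD^\beta u\in L^\infty(\mathbb R^N,\mathbb C^d)$ for $0\le|\beta|\le 2m-2$ and $\langle x\rangle^nD^\beta u\in L^2(\mathbb R^N,\mathbb C^d)$ for $2m-1\le|\beta|\le J$, with the norm $$\|u\|_{\mathcal X_d}=\sum_{|\beta|\le 2m-2}\|\langle x\rangle^nD^\beta u\|_{L^\infty}+\sum_{2m-1\le|\beta|\le J}\|\langle x\rangle^nD^\beta u\|_{L^2}.$$ Let $\gamma_1,\dots,\gamma_N,\eta$ be Hermitian $d\times d$ matrices with $\gamma_j\gamma_l+\gamma_l\gamma_j=2\delta_{jl}I$, $\gamma_j\eta+\eta\gamma_j=0$ and $\eta^2=I$ for $1\le j,l\le N$. Let $H=-i\sum_{l=1}^N\gamma_l\partial_l+\eta$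 be the free Dirac operator, with domain $H^1(\mathbb R^N,\mathbb C^d)$ in $L^2(\mathbb R^N,\mathbb C^d)$, and let $(e^{-itH})_{t\in\mathbb R}$ be the unitary group on $L^2(\mathbb R^N,\mathbb C^d)$ that it generates; that is, $e^{-itH}$ is the Fourier multiplier with symbol $\exp\bigl(-it(\sum_{l}\xi_l\gamma_l+\eta)\bigr)$, where $\xi_l$ corresponds to $-i\partial_l$. Then, for every $\Psi\in\mathcal X_d$, one has $e^{-itH}\Psi\in\mathcal X_d$ for all $t\in\mathbb R$, and the map $t\mapsto e^{-itH}\Psi$ belongs to $C(\mathbb R,\mathcal X_d)$. Moreover, there exist $C>0$ and $t_0>0$ such that, for all $|t|\le t_0$ and all $\Psi\in\mathcal X_d$, $$\|e^{-itH}\Psi\|_{\mathcal X_d}\le C(1+|t|)^{2m+n+1}\|\Psi\|_{\mathcal X_d}$$ and $$\sup_{|\beta|\le 2m}\|\langle x\rangle^nD^\beta(e^{-itH}\Psi-\Psi)\|_{L^\infty}\le C|t|(1+|t|)^{2m+n+1}\|\Psi\|_{\mathcal X_d}.$$ -/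

import Mathlib

open MeasureTheory TemperedDistribution LineDeriv
open scoped ENNReal SchwartzMap FourierTransform

namespace FreeDirac

/-- Euclidean space `ℝ^N`. -/
abbrev Pos (N : ℕ) : Type := EuclideanSpace ℝ (Fin N)

/-- The Hermitian space `ℂ^d`. -/
abbrev Spin (d : ℕ) : Type := EuclideanSpace ℂ (Fin d)

/-- `L²(ℝ^N, ℂ^d)`. -/
abbrev L2 (N d : ℕ) : Type := Lp (Spin d) 2 (volume : Measure (Pos N))

noncomputable section

/-- The distributional derivative `D^β = ∂₁^{β₁} ⋯ ∂_N^{β_N}`. -/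
def multiDeriv {N d : ℕ} (β : Fin N → ℕ) : 𝓢'(Pos N, Spin d) →L[ℂ] 𝓢'(Pos N, Spin d) :=
  (List.ofFn fun i : Fin N =>
    (lineDerivOpCLM ℂ 𝓢'(Pos N, Spin d) (EuclideanSpace.single i (1 : ℝ))) ^ β i).prod

theorem memSobolev_lineDeriv_pow {N d : ℕ} (v : Pos N) (b : ℕ) (s : ℝ)
    (T : 𝓢'(Pos N, Spin d)) (hT : MemSobolev s 2 T) :
    MemSobolev (s - b) 2 (((lineDerivOpCLM ℂ 𝓢'(Pos N, Spin d) v) ^ b) T) := by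
  induction b with
  | zero => simpa using hT
  | succ b ih =>
    rw [pow_succ']
    have := ih.lineDerivOp (m := v)
    rw [sub_sub] at this
    exact_mod_cast this

theorem memSobolev_multiDeriv {N d : ℕ} (β : Fin N → ℕ) (s : ℝ)
    (T : 𝓢'(Pos N, Spin d)) (hT : MemSobolev s 2 T) :
    MemSobolev (s - (∑ i, β i : ℕ)) 2 (multiDeriv β T) := by
  have key : ∀ l : List (Fin N), MemSobolev (s - ((l.map β).sum : ℕ)) 2
      ((l.map fun i : Fin N => (lineDerivOpCLM ℂ 𝓢'(Pos N, Spin d)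
        (EuclideanSpace.single i (1 : ℝ))) ^ β i).prod T) := by
    intro l
    induction l with
    | nil => simpa using hT
    | cons i l ih =>
      have := memSobolev_lineDeriv_pow (EuclideanSpace.single i (1 : ℝ)) (β i) _ _ ih
      rw [sub_sub, add_comm] at this
      simpa [List.map_cons, List.prod_cons] using this
  have := key (List.finRange N)
  rw [multiDeriv, List.ofFn_eq_map]
  rwa [← List.ofFn_eq_map, List.sum_ofFn] at this

theorem exists_weakDeriv {N d : ℕ} (β : Fin N → ℕ) (J : ℕ) (hβ : ∑ i, β i ≤ J)
    (T : 𝓢'(Pos N, Spin d)) (hT : MemSobolev (J : ℝ) 2 T) :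
    ∃ g : L2 N d, multiDeriv β T = (g : 𝓢'(Pos N, Spin d)) := by
  have h := memSobolev_multiDeriv β _ T hT
  have h0 : (0 : ℝ) ≤ (J : ℝ) - (∑ i, β i : ℕ) := by
    rw [sub_nonneg]; exact_mod_cast hβ
  exact memSobolev_zero_iff.1 (h.mono h0)

open Classical in
/-- The weak derivative `D^β u` of `u ∈ L²`, as an element of `L²`, whenever the distribution
`D^β u` is given by a (necessarily unique) square integrable function. -/
def weakDeriv {N d : ℕ} (β : Fin N → ℕ) (u : L2 N d) : L2 N d :=
  if h : ∃ g : L2 N d, multiDeriv β (u : 𝓢'(Pos N, Spin d)) = (g : 𝓢'(Pos N, Spin d))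
  then h.choose else 0

theorem toTempered_injective {N d : ℕ} {f g : L2 N d}
    (h : (f : 𝓢'(Pos N, Spin d)) = (g : 𝓢'(Pos N, Spin d))) : f = g :=
  LinearMap.ker_eq_bot.1
    (Lp.ker_toTemperedDistributionCLM_eq_bot (F := Spin d) (μ := (volume : Measure (Pos N)))
      (p := 2)) h

theorem weakDeriv_eq {N d : ℕ} {β : Fin N → ℕ} {u g : L2 N d}
    (h : multiDeriv β (u : 𝓢'(Pos N, Spin d)) = (g : 𝓢'(Pos N, Spin d))) :
    weakDeriv β u = g := by
  have hex : ∃ g : L2 N d, multiDeriv β (u : 𝓢'(Pos N, Spin d)) = (g : 𝓢'(Pos N, Spin d)) :=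
    ⟨g, h⟩
  rw [weakDeriv, dif_pos hex]
  exact toTempered_injective (hex.choose_spec.symm.trans h)

theorem multiDeriv_eq_weakDeriv {N d : ℕ} {β : Fin N → ℕ} {J : ℕ} (hβ : ∑ i, β i ≤ J) {u : L2 N d}
    (hu : MemSobolev (J : ℝ) 2 (u : 𝓢'(Pos N, Spin d))) :
    multiDeriv β (u : 𝓢'(Pos N, Spin d)) = (weakDeriv β u : 𝓢'(Pos N, Spin d)) := by
  obtain ⟨g, hg⟩ := exists_weakDeriv β J hβ _ hu
  rw [weakDeriv_eq hg, hg]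

theorem toTempered_add {N d : ℕ} (f g : L2 N d) :
    ((f + g : L2 N d) : 𝓢'(Pos N, Spin d)) = (f : 𝓢'(Pos N, Spin d)) + (g : 𝓢'(Pos N, Spin d)) :=
  map_add (Lp.toTemperedDistributionCLM (Spin d) (volume : Measure (Pos N)) 2) f g

theorem toTempered_smul {N d : ℕ} (c : ℂ) (f : L2 N d) :
    ((c • f : L2 N d) : 𝓢'(Pos N, Spin d)) = c • (f : 𝓢'(Pos N, Spin d)) :=
  map_smul (Lp.toTemperedDistributionCLM (Spin d) (volume : Measure (Pos N)) 2) c f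

theorem toTempered_zero {N d : ℕ} :
    ((0 : L2 N d) : 𝓢'(Pos N, Spin d)) = 0 :=
  map_zero (Lp.toTemperedDistributionCLM (Spin d) (volume : Measure (Pos N)) 2)

theorem weakDeriv_add {N d : ℕ} {β : Fin N → ℕ} {J : ℕ} (hβ : ∑ i, β i ≤ J) {u v : L2 N d}
    (hu : MemSobolev (J : ℝ) 2 (u : 𝓢'(Pos N, Spin d)))
    (hv : MemSobolev (J : ℝ) 2 (v : 𝓢'(Pos N, Spin d))) :
    weakDeriv β (u + v) = weakDeriv β u + weakDeriv β v := by
  apply weakDeriv_eq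
  rw [toTempered_add, toTempered_add, map_add, multiDeriv_eq_weakDeriv hβ hu,
    multiDeriv_eq_weakDeriv hβ hv]

theorem weakDeriv_smul {N d : ℕ} {β : Fin N → ℕ} {J : ℕ} (hβ : ∑ i, β i ≤ J) (c : ℂ) {u : L2 N d}
    (hu : MemSobolev (J : ℝ) 2 (u : 𝓢'(Pos N, Spin d))) :
    weakDeriv β (c • u) = c • weakDeriv β u := by
  apply weakDeriv_eq
  rw [toTempered_smul, toTempered_smul, map_smul, multiDeriv_eq_weakDeriv hβ hu]

theorem weakDeriv_zero_right {N d : ℕ} (β : Fin N → ℕ) : weakDeriv β (0 : L2 N d) = 0 := by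
  apply weakDeriv_eq
  rw [toTempered_zero, map_zero]

theorem weakDeriv_zero_left {N d : ℕ} (u : L2 N d) : weakDeriv (0 : Fin N → ℕ) u = u := by
  apply weakDeriv_eq
  simp [multiDeriv, List.ofFn_const]

/-- The bracket `⟨x⟩ = (1 + |x|²)^{1/2}`. -/
def bracket {N : ℕ} (x : Pos N) : ℝ := Real.sqrt (1 + ‖x‖ ^ 2)

/-- `‖⟨x⟩ⁿ f‖_{L^p}`, with value `∞` if `⟨x⟩ⁿ f ∉ L^p`. -/
def wNorm {N d : ℕ} (p : ℝ≥0∞) (n : ℕ) (f : L2 N d) : ℝ≥0∞ :=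
  eLpNorm (fun x : Pos N => (bracket x ^ n) • f x) p volume

theorem aesm_weighted {N d : ℕ} (n : ℕ) (f : L2 N d) :
    AEStronglyMeasurable (fun x : Pos N => (bracket x ^ n) • f x) volume := by
  have hc : Continuous fun x : Pos N => bracket x ^ n := by unfold bracket; fun_prop
  exact hc.aestronglyMeasurable.smul (Lp.aestronglyMeasurable f)

theorem wNorm_add_le {N d : ℕ} {p : ℝ≥0∞} (hp : 1 ≤ p) (n : ℕ) (f g : L2 N d) :
    wNorm p n (f + g) ≤ wNorm p n f + wNorm p n g := by
  have h : (fun x : Pos N => (bracket x ^ n) • (f + g : L2 N d) x) =ᵐ[volume]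
      (fun x : Pos N => (bracket x ^ n) • f x) + fun x : Pos N => (bracket x ^ n) • g x := by
    filter_upwards [Lp.coeFn_add f g] with x hx
    rw [Pi.add_apply, ← smul_add, ← Pi.add_apply (f : Pos N → Spin d), ← hx]
  rw [wNorm, eLpNorm_congr_ae h]
  exact eLpNorm_add_le (aesm_weighted n f) (aesm_weighted n g) hp

theorem wNorm_smul {N d : ℕ} {p : ℝ≥0∞} (n : ℕ) (c : ℂ) (f : L2 N d) :
    wNorm p n (c • f) = ‖c‖ₑ * wNorm p n f := by
  have h : (fun x : Pos N => (bracket x ^ n) • (c • f : L2 N d) x) =ᵐ[volume]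
      c • fun x : Pos N => (bracket x ^ n) • f x := by
    filter_upwards [Lp.coeFn_smul c f] with x hx
    simp only [Pi.smul_apply, hx]
    rw [smul_comm]
  rw [wNorm, eLpNorm_congr_ae h, eLpNorm_const_smul, wNorm]

theorem wNorm_zero {N d : ℕ} (p : ℝ≥0∞) (n : ℕ) : wNorm p n (0 : L2 N d) = 0 := by
  have := wNorm_smul (p := p) n (0 : ℂ) (0 : L2 N d)
  simpa using this

theorem eq_zero_of_wNorm {N d : ℕ} {p : ℝ≥0∞} (hp : p ≠ 0) {n : ℕ} {f : L2 N d}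
    (h : wNorm p n f = 0) : f = 0 := by
  rw [wNorm, eLpNorm_eq_zero_iff (aesm_weighted n f) hp] at h
  rw [Lp.eq_zero_iff_ae_eq_zero]
  filter_upwards [h] with x hx
  have hb : bracket x ^ n ≠ 0 := by
    unfold bracket
    positivity
  simpa [hb] using hx

/-- The multi-indices `β ∈ ℕ^N` of length `|β| = j`. -/
def multiIdx (N j : ℕ) : Finset (Fin N → ℕ) := Finset.univ.piAntidiag j

theorem mem_multiIdx {N j : ℕ} {β : Fin N → ℕ} : β ∈ multiIdx N j ↔ ∑ i, β i = j := by
  simp [multiIdx]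

/-- The set of those `u ∈ H^J(ℝ^N, ℂ^d)`, `J = 2m + 2 + k`, such that `⟨x⟩ⁿ D^β u ∈ L^∞` for
`|β| ≤ 2m - 2` and `⟨x⟩ⁿ D^β u ∈ L²` for `2m - 1 ≤ |β| ≤ J`, as a subspace of `L²`. -/
def spaceXSubmodule (N d k m n : ℕ) : Submodule ℂ (L2 N d) where
  carrier := {u | MemSobolev ((2 * m + 2 + k : ℕ) : ℝ) 2 (u : 𝓢'(Pos N, Spin d)) ∧
    (∀ β : Fin N → ℕ, ∑ i, β i + 2 ≤ 2 * m → wNorm ∞ n (weakDeriv β u) < ∞) ∧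
    (∀ β : Fin N → ℕ, 2 * m ≤ ∑ i, β i + 1 → ∑ i, β i ≤ 2 * m + 2 + k →
      wNorm 2 n (weakDeriv β u) < ∞)}
  zero_mem' := by
    refine ⟨?_, fun β _ => ?_, fun β _ _ => ?_⟩
    · rw [toTempered_zero]; exact memSobolev_fun_zero _ _ _ _
    · rw [weakDeriv_zero_right, wNorm_zero]; simp
    · rw [weakDeriv_zero_right, wNorm_zero]; simp
  add_mem' := by
    rintro u v ⟨hu, hu1, hu2⟩ ⟨hv, hv1, hv2⟩
    refine ⟨?_, fun β hβ => ?_, fun β hβ hβ' => ?_⟩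
    · rw [toTempered_add]; exact hu.add hv
    · rw [weakDeriv_add (by omega) hu hv]
      exact (wNorm_add_le le_top _ _ _).trans_lt (ENNReal.add_lt_top.2 ⟨hu1 β hβ, hv1 β hβ⟩)
    · rw [weakDeriv_add hβ' hu hv]
      exact (wNorm_add_le one_le_two _ _ _).trans_lt
        (ENNReal.add_lt_top.2 ⟨hu2 β hβ hβ', hv2 β hβ hβ'⟩)
  smul_mem' := by
    rintro c u ⟨hu, hu1, hu2⟩
    refine ⟨?_, fun β hβ => ?_, fun β hβ hβ' => ?_⟩
    · rw [toTempered_smul]; exact hu.smul c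
    · rw [weakDeriv_smul (by omega) c hu, wNorm_smul]
      exact ENNReal.mul_lt_top (by simp) (hu1 β hβ)
    · rw [weakDeriv_smul hβ' c hu, wNorm_smul]
      exact ENNReal.mul_lt_top (by simp) (hu2 β hβ hβ')

/-- The space `𝒳_d`, to be equipped with its own norm (not with the norm of `L²`). -/
def SpaceX (N d k m n : ℕ) : Type := spaceXSubmodule N d k m n

namespace SpaceX

variable {N d k m n : ℕ}

instance : AddCommGroup (SpaceX N d k m n) :=
  inferInstanceAs (AddCommGroup (spaceXSubmodule N d k m n))

instance : Module ℂ (SpaceX N d k m n) :=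
  inferInstanceAs (Module ℂ (spaceXSubmodule N d k m n))

/-- The inclusion of `𝒳_d` into `L²`. -/
def toL2 : SpaceX N d k m n →ₗ[ℂ] L2 N d := (spaceXSubmodule N d k m n).subtype

theorem toL2_mem (u : SpaceX N d k m n) : u.toL2 ∈ spaceXSubmodule N d k m n := u.2

theorem toL2_injective : Function.Injective (toL2 : SpaceX N d k m n → L2 N d) :=
  Subtype.val_injective

/-- `∑_{|β| ≤ 2m-2} ‖⟨x⟩ⁿ D^β u‖_{L^∞} + ∑_{2m-1 ≤ |β| ≤ J} ‖⟨x⟩ⁿ D^β u‖_{L²}`, `J = 2m + 2 + k`. -/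
def xNorm (u : SpaceX N d k m n) : ℝ :=
  ∑ j ∈ Finset.range (2 * m - 1), ∑ β ∈ multiIdx N j, (wNorm ∞ n (weakDeriv β u.toL2)).toReal +
  ∑ j ∈ Finset.Icc (2 * m - 1) (2 * m + 2 + k), ∑ β ∈ multiIdx N j,
    (wNorm 2 n (weakDeriv β u.toL2)).toReal

theorem xNorm_zero : xNorm (0 : SpaceX N d k m n) = 0 := by
  simp [xNorm, weakDeriv_zero_right, wNorm_zero]

theorem xNorm_add_le (u v : SpaceX N d k m n) : xNorm (u + v) ≤ xNorm u + xNorm v := by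
  obtain ⟨hu, hu1, hu2⟩ := u.toL2_mem
  obtain ⟨hv, hv1, hv2⟩ := v.toL2_mem
  simp only [xNorm]
  rw [add_add_add_comm]
  simp only [← Finset.sum_add_distrib]
  refine add_le_add (Finset.sum_le_sum fun j hj => Finset.sum_le_sum fun β hβ => ?_)
    (Finset.sum_le_sum fun j hj => Finset.sum_le_sum fun β hβ => ?_)
  · rw [Finset.mem_range] at hj
    rw [mem_multiIdx] at hβ
    rw [map_add, weakDeriv_add (by omega) hu hv,
      ← ENNReal.toReal_add (hu1 β (by omega)).ne (hv1 β (by omega)).ne]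
    exact ENNReal.toReal_mono (ENNReal.add_lt_top.2 ⟨hu1 β (by omega), hv1 β (by omega)⟩).ne
      (wNorm_add_le le_top _ _ _)
  · rw [Finset.mem_Icc] at hj
    rw [mem_multiIdx] at hβ
    rw [map_add, weakDeriv_add (by omega) hu hv,
      ← ENNReal.toReal_add (hu2 β (by omega) (by omega)).ne (hv2 β (by omega) (by omega)).ne]
    exact ENNReal.toReal_mono (ENNReal.add_lt_top.2
      ⟨hu2 β (by omega) (by omega), hv2 β (by omega) (by omega)⟩).ne
      (wNorm_add_le one_le_two _ _ _)

theorem xNorm_smul (c : ℂ) (u : SpaceX N d k m n) : xNorm (c • u) = ‖c‖ * xNorm u := by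
  obtain ⟨hu, hu1, hu2⟩ := u.toL2_mem
  simp only [xNorm]
  rw [mul_add]
  simp only [Finset.mul_sum]
  congr 1
  · refine Finset.sum_congr rfl fun j hj => Finset.sum_congr rfl fun β hβ => ?_
    rw [Finset.mem_range] at hj
    rw [mem_multiIdx] at hβ
    rw [map_smul, weakDeriv_smul (by omega) c hu, wNorm_smul, ENNReal.toReal_mul, toReal_enorm]
  · refine Finset.sum_congr rfl fun j hj => Finset.sum_congr rfl fun β hβ => ?_
    rw [Finset.mem_Icc] at hj
    rw [mem_multiIdx] at hβ
    rw [map_smul, weakDeriv_smul (by omega) c hu, wNorm_smul, ENNReal.toReal_mul, toReal_enorm]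

theorem eq_zero_of_xNorm (u : SpaceX N d k m n) (h : xNorm u = 0) : u = 0 := by
  obtain ⟨hu, hu1, hu2⟩ := u.toL2_mem
  apply toL2_injective
  rw [map_zero]
  rw [xNorm, add_eq_zero_iff_of_nonneg
    (Finset.sum_nonneg fun _ _ => Finset.sum_nonneg fun _ _ => ENNReal.toReal_nonneg)
    (Finset.sum_nonneg fun _ _ => Finset.sum_nonneg fun _ _ => ENNReal.toReal_nonneg)] at h
  obtain ⟨h1, h2⟩ := h
  have h0 : (0 : Fin N → ℕ) ∈ multiIdx N 0 := by simp [mem_multiIdx]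
  rcases Nat.eq_zero_or_pos m with hm | hm
  · rw [Finset.sum_eq_zero_iff_of_nonneg
      (fun _ _ => Finset.sum_nonneg fun _ _ => ENNReal.toReal_nonneg)] at h2
    have h3 := h2 0 (by simp [hm])
    rw [Finset.sum_eq_zero_iff_of_nonneg (fun _ _ => ENNReal.toReal_nonneg)] at h3
    have h4 := h3 0 h0
    rw [ENNReal.toReal_eq_zero_iff] at h4
    rcases h4 with h4 | h4
    · rw [weakDeriv_zero_left] at h4
      exact eq_zero_of_wNorm (by norm_num) h4
    · exact absurd h4 (hu2 0 (by simp [hm]) (by simp)).ne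
  · rw [Finset.sum_eq_zero_iff_of_nonneg
      (fun _ _ => Finset.sum_nonneg fun _ _ => ENNReal.toReal_nonneg)] at h1
    have h3 := h1 0 (Finset.mem_range.2 (by omega))
    rw [Finset.sum_eq_zero_iff_of_nonneg (fun _ _ => ENNReal.toReal_nonneg)] at h3
    have h4 := h3 0 h0
    rw [ENNReal.toReal_eq_zero_iff] at h4
    rcases h4 with h4 | h4
    · rw [weakDeriv_zero_left] at h4
      exact eq_zero_of_wNorm (by simp) h4
    · exact absurd h4 (hu1 0 (by simp; omega)).ne

instance : NormedAddCommGroup (SpaceX N d k m n) :=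
  AddGroupNorm.toNormedAddCommGroup
    { toFun := xNorm
      map_zero' := xNorm_zero
      add_le' := xNorm_add_le
      neg' := fun u => by
        have := xNorm_smul (-1 : ℂ) u
        simpa using this
      eq_zero_of_map_eq_zero' := eq_zero_of_xNorm }

theorem norm_eq_xNorm (u : SpaceX N d k m n) : ‖u‖ = xNorm u := rfl

instance : NormedSpace ℂ (SpaceX N d k m n) where
  norm_smul_le c u := (xNorm_smul c u).le

end SpaceX


/-- The dimension `2^{[(N+1)/2]}` of the spinor space. -/
def diracDim (N : ℕ) : ℕ := 2 ^ ((N + 1) / 2)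

/-- Hermitian matrices `γ₁, …, γ_N, η` of size `2^{[(N+1)/2]}` satisfying the anticommutation
relations of the Dirac operator. -/
structure DiracMatrices (N : ℕ) where
  γ : Fin N → Matrix (Fin (diracDim N)) (Fin (diracDim N)) ℂ
  η : Matrix (Fin (diracDim N)) (Fin (diracDim N)) ℂ
  γ_hermitian : ∀ j, (γ j).IsHermitian
  η_hermitian : η.IsHermitian
  γ_anticomm : ∀ j l, γ j * γ l + γ l * γ j = if j = l then 2 else 0
  γ_η_anticomm : ∀ j, γ j * η + η * γ j = 0
  η_sq : η * η = 1

/-- A matrix acting on `ℂ^d` with its Hermitian norm. -/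
abbrev matCLM {d : ℕ} (A : Matrix (Fin d) (Fin d) ℂ) : Spin d →L[ℂ] Spin d :=
  Matrix.toEuclideanCLM (𝕜 := ℂ) (n := Fin d) A

/-- The free Dirac operator `H u = -i ∑ₗ γₗ ∂ₗ u + η u`; its domain is `H¹(ℝ^N, ℂ^d)`. -/
def diracOp {N : ℕ} (D : DiracMatrices N) (u : L2 N (diracDim N)) : L2 N (diracDim N) :=
  -Complex.I • ∑ l, (matCLM (D.γ l)).compLp (weakDeriv (Pi.single l 1) u) + (matCLM D.η).compLp u

section Propagator

variable {V : Type*} [NormedAddCommGroup V] [InnerProductSpace ℂ V] [CompleteSpace V]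

/-- `exp(-itA)` for a bounded operator `A`. -/
def expI (t : ℝ) (A : V →L[ℂ] V) : V →L[ℂ] V := NormedSpace.exp ((-(t : ℂ) * Complex.I) • A)

theorem expI_zero (A : V →L[ℂ] V) : expI 0 A = 1 := by simp [expI]

theorem expI_add (s t : ℝ) (A : V →L[ℂ] V) : expI (s + t) A = expI s A * expI t A := by
  let +nondep : NormedAlgebra ℚ (V →L[ℂ] V) := .restrictScalars ℚ ℂ _
  rw [expI, expI, expI,
    ← NormedSpace.exp_add_of_commute (((Commute.refl _).smul_left _).smul_right _), ← add_smul]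
  congr 2
  push_cast
  ring

theorem norm_expI_apply (t : ℝ) {A : V →L[ℂ] V} (hA : IsSelfAdjoint A) (v : V) :
    ‖expI t A v‖ = ‖v‖ := by
  have h : IsSelfAdjoint ((-(t : ℂ)) • A) := IsSelfAdjoint.smul (by simp [isSelfAdjoint_iff]) hA
  have h2 : expI t A ∈ unitary (V →L[ℂ] V) := by
    have := (selfAdjoint.expUnitary ⟨_, h⟩).2
    rwa [selfAdjoint.expUnitary_coe, smul_smul, mul_comm] at this
  exact (ContinuousLinearMap.norm_map_iff_adjoint_comp_self _).2 (Unitary.mem_iff.1 h2).1 v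

theorem continuous_expI (t : ℝ) : Continuous (expI t : (V →L[ℂ] V) → V →L[ℂ] V) := by
  let +nondep : NormedAlgebra ℚ (V →L[ℂ] V) := .restrictScalars ℚ ℂ _
  exact NormedSpace.exp_continuous.comp (continuous_const_smul (-(t : ℂ) * Complex.I))

theorem hasDerivAt_expI_apply (t : ℝ) (A : V →L[ℂ] V) (v : V) :
    HasDerivAt (fun s : ℝ => expI s A v) (-Complex.I • expI t A (A v)) t := by
  have h1 := hasDerivAt_exp_smul_const (𝕂 := ℝ) (-Complex.I • A) t
  have h2 : (fun s : ℝ => expI s A v) =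
      fun s : ℝ => NormedSpace.exp (s • (-Complex.I • A)) v := by
    funext s
    rw [expI, ← Complex.coe_smul, smul_smul, neg_mul, mul_neg]
  have h3 := ((ContinuousLinearMap.apply ℂ V v).restrictScalars ℝ).hasFDerivAt.comp_hasDerivAt t h1
  rw [h2]
  convert! h3 using 1
  rw [expI, ← Complex.coe_smul, smul_smul, mul_neg, neg_mul]
  simp

theorem norm_expI_sub_le (t : ℝ) {A : V →L[ℂ] V} (hA : IsSelfAdjoint A) (v : V) :
    ‖expI t A v - v‖ ≤ |t| * ‖A v‖ := by
  have h := (convex_univ (𝕜 := ℝ) (E := ℝ)).norm_image_sub_le_of_norm_hasDerivWithin_le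
    (f := fun s : ℝ => expI s A v) (f' := fun s => -Complex.I • expI s A (A v)) (C := ‖A v‖)
    (x := 0) (y := t) (fun s _ => (hasDerivAt_expI_apply s A v).hasDerivWithinAt)
    (fun s _ => by rw [norm_smul, norm_expI_apply s hA]; simp) trivial trivial
  simpa [expI_zero, mul_comm] using h

end Propagator

theorem isSelfAdjoint_matCLM {d : ℕ} {A : Matrix (Fin d) (Fin d) ℂ} (hA : A.IsHermitian) :
    IsSelfAdjoint (matCLM A) :=
  IsSelfAdjoint.map (show IsSelfAdjoint A from hA) _

/-- The symbol `∑ₗ (2π ξₗ) γₗ + η` of the free Dirac operator, for the Fourier transform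
`∫ e^{-2π i x·ξ} u(x) dx`. -/
def diracSymbol {N : ℕ} (D : DiracMatrices N) (ξ : Pos N) :
    Spin (diracDim N) →L[ℂ] Spin (diracDim N) :=
  matCLM (∑ l, ((2 * Real.pi * ξ l : ℝ) : ℂ) • D.γ l + D.η)

theorem diracSymbol_isSelfAdjoint {N : ℕ} (D : DiracMatrices N) (ξ : Pos N) :
    IsSelfAdjoint (diracSymbol D ξ) := by
  refine isSelfAdjoint_matCLM (IsSelfAdjoint.add (isSelfAdjoint_sum _ fun l _ => ?_) D.η_hermitian)
  exact IsSelfAdjoint.smul (by simp [isSelfAdjoint_iff])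
    (show IsSelfAdjoint (D.γ l) from D.γ_hermitian l)

theorem diracSymbol_apply {N : ℕ} (D : DiracMatrices N) (ξ : Pos N) (v : Spin (diracDim N)) :
    diracSymbol D ξ v =
      ∑ l, ((2 * Real.pi * ξ l : ℝ) : ℂ) • matCLM (D.γ l) v + matCLM D.η v := by
  rw [diracSymbol, matCLM, map_add, map_sum, add_apply, sum_apply]
  simp only [map_smul]
  rfl

theorem continuous_diracSymbol {N : ℕ} (D : DiracMatrices N) : Continuous (diracSymbol D) := by
  have h : Continuous fun A : Matrix (Fin (diracDim N)) (Fin (diracDim N)) ℂ => matCLM A :=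
    LinearMap.continuous_of_finiteDimensional
      ((Matrix.toEuclideanCLM (𝕜 := ℂ) (n := Fin (diracDim N))).toAlgEquiv.toLinearMap)
  exact h.comp (by fun_prop)

theorem memLp_expI {N : ℕ} (D : DiracMatrices N) (t : ℝ) (f : L2 N (diracDim N)) :
    MemLp (fun ξ : Pos N => expI t (diracSymbol D ξ) (f ξ)) 2 volume := by
  refine (Lp.memLp f).congr_norm ?_ (Filter.Eventually.of_forall fun ξ => ?_)
  · have h1 : AEStronglyMeasurable (fun ξ : Pos N => expI t (diracSymbol D ξ)) volume :=
      ((continuous_expI t).comp (continuous_diracSymbol D)).aestronglyMeasurable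
    have h2 : AEStronglyMeasurable (f : Pos N → Spin (diracDim N)) volume :=
      Lp.aestronglyMeasurable f
    exact (ContinuousLinearMap.apply ℂ (Spin (diracDim N))).flip.aestronglyMeasurable_comp₂ h1 h2
  · exact (norm_expI_apply t (diracSymbol_isSelfAdjoint D ξ) _).symm

/-- Multiplication by `exp(-i t (∑ₗ (2π ξₗ) γₗ + η))` on `L²`. -/
def diracMul {N : ℕ} (D : DiracMatrices N) (t : ℝ) :
    L2 N (diracDim N) →ₗᵢ[ℂ] L2 N (diracDim N) where
  toFun f := (memLp_expI D t f).toLp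
  map_add' f g := by
    ext1
    filter_upwards [(memLp_expI D t (f + g)).coeFn_toLp,
      (memLp_expI D t f).coeFn_toLp, (memLp_expI D t g).coeFn_toLp,
      Lp.coeFn_add f g, Lp.coeFn_add (memLp_expI D t f).toLp
        (memLp_expI D t g).toLp] with ξ h1 h2 h3 h4 h5
    rw [h1, h5, Pi.add_apply, h2, h3, h4, Pi.add_apply, map_add]
  map_smul' c f := by
    ext1
    filter_upwards [(memLp_expI D t (c • f)).coeFn_toLp,
      (memLp_expI D t f).coeFn_toLp,
      Lp.coeFn_smul c f, Lp.coeFn_smul c (memLp_expI D t f).toLp] with ξ h1 h2 h3 h4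
    rw [h1, RingHom.id_apply, h4, Pi.smul_apply, h2, h3, Pi.smul_apply, map_smul]
  norm_map' f := by
    change ‖(memLp_expI D t f).toLp‖ = ‖f‖
    rw [Lp.norm_toLp, Lp.norm_def]
    congr 1
    exact eLpNorm_congr_norm_ae
      (Filter.Eventually.of_forall fun ξ => norm_expI_apply t (diracSymbol_isSelfAdjoint D ξ) _)

theorem coeFn_diracMul {N : ℕ} (D : DiracMatrices N) (t : ℝ) (f : L2 N (diracDim N)) :
    diracMul D t f =ᵐ[volume] fun ξ => expI t (diracSymbol D ξ) (f ξ) :=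
  (memLp_expI D t f).coeFn_toLp

/-- The free Dirac group `e^{-itH}` on `L²(ℝ^N, ℂ^d)`, i.e.
`e^{-itH} u = 𝓕⁻¹ (exp(-i t (∑ₗ (2π ξₗ) γₗ + η)) 𝓕 u)`. -/
def diracGroup {N : ℕ} (D : DiracMatrices N) (t : ℝ) :
    L2 N (diracDim N) →ₗᵢ[ℂ] L2 N (diracDim N) :=
  (Lp.fourierTransformₗᵢ (Pos N) (Spin (diracDim N))).symm.toLinearIsometry.comp
    ((diracMul D t).comp (Lp.fourierTransformₗᵢ (Pos N) (Spin (diracDim N))).toLinearIsometry)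

theorem diracGroup_apply {N : ℕ} (D : DiracMatrices N) (t : ℝ) (u : L2 N (diracDim N)) :
    diracGroup D t u = 𝓕⁻ (diracMul D t (𝓕 u)) := rfl

theorem diracGroup_zero {N : ℕ} (D : DiracMatrices N) (u : L2 N (diracDim N)) :
    diracGroup D 0 u = u := by
  have h : ∀ f : L2 N (diracDim N), diracMul D 0 f = f := fun f => by
    ext1
    filter_upwards [coeFn_diracMul D 0 f] with ξ h
    rw [h, expI_zero]
    rfl
  rw [diracGroup_apply, h]
  exact (Lp.fourierTransformₗᵢ (Pos N) (Spin (diracDim N))).symm_apply_apply u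

theorem diracGroup_add {N : ℕ} (D : DiracMatrices N) (s t : ℝ) (u : L2 N (diracDim N)) :
    diracGroup D (s + t) u = diracGroup D s (diracGroup D t u) := by
  have h : ∀ f : L2 N (diracDim N), diracMul D (s + t) f = diracMul D s (diracMul D t f) :=
    fun f => by
    ext1
    filter_upwards [coeFn_diracMul D (s + t) f, coeFn_diracMul D s (diracMul D t f),
      coeFn_diracMul D t f] with ξ h1 h2 h3
    rw [h1, h2, h3, expI_add]
    rfl
  rw [diracGroup_apply, h, diracGroup_apply, diracGroup_apply]
  congr 2
  exact ((Lp.fourierTransformₗᵢ (Pos N) (Spin (diracDim N))).apply_symm_apply _).symm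

theorem fourier_compLp {N d : ℕ} (A : Spin d →L[ℂ] Spin d) (u : L2 N d) :
    𝓕 (A.compLp u) = A.compLp (𝓕 u) := by
  have key : ∀ (v : L2 N d) (φ : 𝓢(Pos N, ℂ)),
      ((A.compLp v : L2 N d) : 𝓢'(Pos N, Spin d)) φ = A ((v : 𝓢'(Pos N, Spin d)) φ) := by
    intro v φ
    rw [Lp.toTemperedDistribution_apply, Lp.toTemperedDistribution_apply,
      ← ContinuousLinearMap.integral_comp_comm]
    · refine integral_congr_ae ?_
      filter_upwards [A.coeFn_compLp v] with x hx
      rw [hx, map_smul]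
    · exact memLp_one_iff_integrable.1 ((Lp.memLp v).smul (φ.memLp 2 volume))
  apply toTempered_injective
  ext1 φ
  rw [← Lp.fourier_toTemperedDistribution_eq, TemperedDistribution.fourier_apply, key, key,
    ← Lp.fourier_toTemperedDistribution_eq, TemperedDistribution.fourier_apply]

theorem multiDeriv_single {N d : ℕ} (l : Fin N) (T : 𝓢'(Pos N, Spin d)) :
    multiDeriv (Pi.single l 1) T = ∂_{EuclideanSpace.single l (1 : ℝ)} T := by
  have key : ∀ L : List (Fin N), L.Nodup →
      (L.map fun i : Fin N => (lineDerivOpCLM ℂ 𝓢'(Pos N, Spin d)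
        (EuclideanSpace.single i (1 : ℝ))) ^ (Pi.single l 1 : Fin N → ℕ) i).prod =
      if l ∈ L then lineDerivOpCLM ℂ 𝓢'(Pos N, Spin d) (EuclideanSpace.single l (1 : ℝ)) else 1 := by
    intro L hL
    induction L with
    | nil => simp
    | cons a L ih =>
      rw [List.nodup_cons] at hL
      rw [List.map_cons, List.prod_cons, ih hL.2]
      by_cases h : a = l
      · subst h
        simp [hL.1]
      · simp [h, Ne.symm h]
  rw [multiDeriv, List.ofFn_eq_map, key _ (List.nodup_finRange N)]
  simp

theorem fourier_weakDeriv_single {N d : ℕ} (l : Fin N) {u : L2 N d}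
    (hu : MemSobolev 1 2 (u : 𝓢'(Pos N, Spin d))) :
    (𝓕 (weakDeriv (Pi.single l 1) u) : L2 N d) =ᵐ[volume]
      fun ξ => (2 * Real.pi * Complex.I * (ξ l : ℂ)) • (𝓕 u : L2 N d) ξ := by
  have hin : ∀ ξ : Pos N, inner ℝ ξ (EuclideanSpace.single l (1 : ℝ)) = ξ l := fun ξ => by
    rw [EuclideanSpace.inner_single_right]; simp
  have h2 : ((𝓕 (weakDeriv (Pi.single l 1) u) : L2 N d) : 𝓢'(Pos N, Spin d)) =
      (2 * Real.pi * Complex.I) • smulLeftCLM (Spin d)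
        (fun x : Pos N => ((inner ℝ x (EuclideanSpace.single l (1 : ℝ)) : ℝ) : ℂ))
        ((𝓕 u : L2 N d) : 𝓢'(Pos N, Spin d)) := by
    rw [← Lp.fourier_toTemperedDistribution_eq, ← Lp.fourier_toTemperedDistribution_eq,
      ← multiDeriv_eq_weakDeriv (J := 1) (by simp) (by simpa using hu), multiDeriv_single,
      TemperedDistribution.fourier_lineDerivOp_eq]
  have hc : Continuous fun ξ : Pos N => (2 * Real.pi * Complex.I * (ξ l : ℂ)) := by fun_prop
  have hloc : LocallyIntegrable (𝓕 u : L2 N d) volume :=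
    (Lp.memLp (𝓕 u : L2 N d)).locallyIntegrable one_le_two
  refine ae_eq_of_integral_contDiff_smul_eq
    ((Lp.memLp _).locallyIntegrable one_le_two) ?_ ?_
  · rw [← locallyIntegrableOn_univ] at hloc ⊢
    exact hloc.continuousOn_smul isOpen_univ.isLocallyClosed hc.continuousOn
  intro g g_smooth g_cpt
  have hg₁ : HasCompactSupport (Complex.ofRealCLM ∘ g) := g_cpt.comp_left rfl
  have hg₂ : ContDiff ℝ ((⊤ : ℕ∞) : WithTop ℕ∞) (Complex.ofRealCLM ∘ g) := by fun_prop
  have h3 := congrArg (fun T : 𝓢'(Pos N, Spin d) => T (hg₁.toSchwartzMap hg₂)) h2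
  have htg : (fun x : Pos N =>
      ((inner ℝ x (EuclideanSpace.single l (1 : ℝ)) : ℝ) : ℂ)).HasTemperateGrowth := by fun_prop
  rw [Lp.toTemperedDistribution_apply] at h3
  have h4 : ((2 * Real.pi * Complex.I) • smulLeftCLM (Spin d)
        (fun x : Pos N => ((inner ℝ x (EuclideanSpace.single l (1 : ℝ)) : ℝ) : ℂ))
        ((𝓕 u : L2 N d) : 𝓢'(Pos N, Spin d))) (hg₁.toSchwartzMap hg₂) =
      (2 * Real.pi * Complex.I) • ∫ x : Pos N, ((x l : ℂ) * (g x : ℂ)) • (𝓕 u : L2 N d) x := by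
    change (2 * Real.pi * Complex.I) • (smulLeftCLM (Spin d)
        (fun x : Pos N => ((inner ℝ x (EuclideanSpace.single l (1 : ℝ)) : ℝ) : ℂ))
        ((𝓕 u : L2 N d) : 𝓢'(Pos N, Spin d))) (hg₁.toSchwartzMap hg₂) = _
    rw [TemperedDistribution.smulLeftCLM_apply_apply, Lp.toTemperedDistribution_apply]
    congr 1
    refine integral_congr_ae (Filter.Eventually.of_forall fun x => ?_)
    simp only []
    rw [SchwartzMap.smulLeftCLM_apply_apply htg, hin]
    rfl
  have h5 := h3.trans h4
  rw [← integral_smul] at h5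
  calc ∫ x, g x • (𝓕 (weakDeriv (Pi.single l 1) u) : L2 N d) x
      = ∫ x, (hg₁.toSchwartzMap hg₂) x • (𝓕 (weakDeriv (Pi.single l 1) u) : L2 N d) x := by
        refine integral_congr_ae (Filter.Eventually.of_forall fun x => ?_)
        exact (Complex.coe_smul (g x) _).symm
    _ = _ := h5
    _ = _ := by
        refine integral_congr_ae (Filter.Eventually.of_forall fun x => ?_)
        simp only []
        rw [smul_smul, ← Complex.coe_smul (g x), smul_smul]
        congr 1
        ring

theorem fourier_diracOp {N : ℕ} (D : DiracMatrices N) {u : L2 N (diracDim N)}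
    (hu : MemSobolev 1 2 (u : 𝓢'(Pos N, Spin (diracDim N)))) :
    (𝓕 (diracOp D u) : L2 N (diracDim N)) =ᵐ[volume]
      fun ξ => diracSymbol D ξ ((𝓕 u : L2 N (diracDim N)) ξ) := by
  have h1 : (𝓕 (diracOp D u) : L2 N (diracDim N)) =
      -Complex.I • ∑ l, (matCLM (D.γ l)).compLp (𝓕 (weakDeriv (Pi.single l 1) u)) +
        (matCLM D.η).compLp (𝓕 u) := by
    have h := fun v => fourier_compLp (d := diracDim N) (N := N) (matCLM D.η) v
    rw [diracOp]
    change Lp.fourierTransformₗᵢ (Pos N) (Spin (diracDim N)) _ = _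
    rw [map_add, map_smul, map_sum, ← fourier_compLp]
    congr 2
    exact Finset.sum_congr rfl fun l _ => fourier_compLp _ _
  rw [h1]
  have h2 : ∀ᵐ ξ : Pos N, ∀ l : Fin N,
      ((matCLM (D.γ l)).compLp (𝓕 (weakDeriv (Pi.single l 1) u)) : L2 N (diracDim N)) ξ =
        (2 * Real.pi * Complex.I * (ξ l : ℂ)) • matCLM (D.γ l) ((𝓕 u : L2 N (diracDim N)) ξ) := by
    rw [ae_all_iff]
    intro l
    filter_upwards [(matCLM (D.γ l)).coeFn_compLp (𝓕 (weakDeriv (Pi.single l 1) u)),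
      fourier_weakDeriv_single l hu] with ξ h3 h4
    rw [h3, h4, map_smul]
  filter_upwards [h2, Lp.coeFn_add (-Complex.I • ∑ l, (matCLM (D.γ l)).compLp
      (𝓕 (weakDeriv (Pi.single l 1) u))) ((matCLM D.η).compLp (𝓕 u)),
    Lp.coeFn_smul (-Complex.I) (∑ l, (matCLM (D.γ l)).compLp (𝓕 (weakDeriv (Pi.single l 1) u))),
    Lp.coeFn_finsetSum Finset.univ (fun l => (matCLM (D.γ l)).compLp
      (𝓕 (weakDeriv (Pi.single l 1) u))),
    (matCLM D.η).coeFn_compLp (𝓕 u : L2 N (diracDim N))] with ξ h3 h4 h5 h6 h7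
  rw [h4, Pi.add_apply, h5, Pi.smul_apply, h6, h7, diracSymbol_apply, Finset.sum_apply,
    Finset.smul_sum]
  congr 1
  refine Finset.sum_congr rfl fun l _ => ?_
  rw [h3, smul_smul]
  congr 1
  push_cast
  linear_combination (-2 * Real.pi * (ξ l : ℂ)) * Complex.I_mul_I

theorem hasDerivAt_diracMul {N : ℕ} (D : DiracMatrices N) {f g : L2 N (diracDim N)}
    (hg : g =ᵐ[volume] fun ξ => diracSymbol D ξ (f ξ)) :
    HasDerivAt (fun s => diracMul D s f) (-Complex.I • g) 0 := by
  rw [hasDerivAt_iff_tendsto_slope_zero, Lp.tendsto_Lp_iff_tendsto_eLpNorm']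
  simp_rw [eLpNorm_eq_lintegral_rpow_enorm_toReal (p := 2) (by norm_num) (by norm_num)]
  have hae : ∀ s : ℝ,
      ((s⁻¹ • (diracMul D (0 + s) f - diracMul D 0 f) : L2 N (diracDim N)) :
          Pos N → Spin (diracDim N)) -
        ((-Complex.I • g : L2 N (diracDim N)) : Pos N → Spin (diracDim N)) =ᵐ[volume] fun ξ =>
        s⁻¹ • (expI s (diracSymbol D ξ) (f ξ) - f ξ) + Complex.I • diracSymbol D ξ (f ξ) := by
    intro s
    filter_upwards [hg, Lp.coeFn_smul s⁻¹ (diracMul D (0 + s) f - diracMul D 0 f),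
      Lp.coeFn_sub (diracMul D (0 + s) f) (diracMul D 0 f), coeFn_diracMul D (0 + s) f,
      coeFn_diracMul D 0 f, Lp.coeFn_smul (-Complex.I) g] with ξ h1 h2 h3 h4 h5 h6
    rw [Pi.sub_apply, h2, Pi.smul_apply, h3, Pi.sub_apply, h4, h5, h6, Pi.smul_apply, h1, expI_zero,
      zero_add, neg_smul, sub_neg_eq_add]
    rfl
  have hlim : Filter.Tendsto (fun s : ℝ => ∫⁻ ξ : Pos N,
      ‖s⁻¹ • (expI s (diracSymbol D ξ) (f ξ) - f ξ) + Complex.I • diracSymbol D ξ (f ξ)‖ₑ ^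
        (2 : ℝ≥0∞).toReal) (nhdsWithin 0 {0}ᶜ) (nhds (∫⁻ _ : Pos N, 0)) := by
    refine tendsto_lintegral_filter_of_dominated_convergence
      (fun ξ => (2 * ‖g ξ‖ₑ) ^ (2 : ℝ≥0∞).toReal) ?_ ?_ ?_ ?_
    · refine Filter.Eventually.of_forall fun s => ?_
      have hf : StronglyMeasurable (f : Pos N → Spin (diracDim N)) := Lp.stronglyMeasurable f
      have h1 : ∀ B : Pos N → Spin (diracDim N) →L[ℂ] Spin (diracDim N), Continuous B →
          StronglyMeasurable fun ξ => B ξ (f ξ) := fun B hB =>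
        (ContinuousLinearMap.apply ℂ (Spin (diracDim N))).flip.continuous₂.comp_stronglyMeasurable
          (hB.stronglyMeasurable.prodMk hf)
      have h2 := h1 _ ((continuous_expI s).comp (continuous_diracSymbol D))
      have h3 := h1 _ (continuous_diracSymbol D)
      exact (((h2.sub hf).const_smul s⁻¹).add (h3.const_smul Complex.I)).enorm.pow_const _
    · filter_upwards [self_mem_nhdsWithin] with s hs
      filter_upwards [hg] with ξ h1
      refine ENNReal.rpow_le_rpow ?_ (by simp)
      have h2 : ‖s⁻¹ • (expI s (diracSymbol D ξ) (f ξ) - f ξ)‖ ≤ ‖g ξ‖ := by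
        have h3 := norm_expI_sub_le s (diracSymbol_isSelfAdjoint D ξ) (f ξ)
        rw [← h1] at h3
        rw [norm_smul, norm_inv, Real.norm_eq_abs,
          inv_mul_le_iff₀ (abs_pos.2 (by simpa using hs))]
        exact h3
      refine (enorm_add_le _ _).trans ?_
      rw [two_mul]
      refine add_le_add (enorm_le_iff_norm_le.2 h2) (enorm_le_iff_norm_le.2 ?_)
      rw [norm_smul, Complex.norm_I, one_mul, h1]
    · simp_rw [ENNReal.mul_rpow_of_nonneg _ _ (ENNReal.toReal_nonneg (a := 2))]
      rw [lintegral_const_mul' _ _ (by simp)]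
      exact ENNReal.mul_ne_top (by simp) (lintegral_rpow_enorm_lt_top_of_eLpNorm_lt_top
        (by norm_num) (by norm_num) (Lp.memLp g).2).ne
    · refine Filter.Eventually.of_forall fun ξ => ?_
      have h1 := hasDerivAt_iff_tendsto_slope_zero.1
        (hasDerivAt_expI_apply 0 (diracSymbol D ξ) (f ξ))
      have h2 := (h1.add_const (Complex.I • diracSymbol D ξ (f ξ))).enorm.ennrpow_const
        (2 : ℝ≥0∞).toReal
      simpa [expI_zero] using h2
  have hfin := hlim.ennrpow_const (1 / (2 : ℝ≥0∞).toReal)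
  rw [lintegral_zero, ENNReal.zero_rpow_of_pos (by simp)] at hfin
  refine hfin.congr fun s => ?_
  congr 1
  exact lintegral_congr_ae ((hae s).fun_comp fun v => ‖v‖ₑ ^ (2 : ℝ≥0∞).toReal).symm

/-- `e^{-itH}` is generated by `H`: for `u ∈ H¹`, `∂ₜ e^{-itH} u = -i e^{-itH} H u` in `L²`. -/
theorem hasDerivAt_diracGroup {N : ℕ} (D : DiracMatrices N) {u : L2 N (diracDim N)}
    (hu : MemSobolev 1 2 (u : 𝓢'(Pos N, Spin (diracDim N)))) (t : ℝ) :
    HasDerivAt (fun s => diracGroup D s u) (-Complex.I • diracGroup D t (diracOp D u)) t := by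
  have h0 : HasDerivAt (fun s => diracGroup D s u) (-Complex.I • diracOp D u) 0 := by
    have h1 := hasDerivAt_diracMul D (fourier_diracOp D hu)
    have h2 := (((Lp.fourierTransformₗᵢ (Pos N) (Spin (diracDim N))).symm.toContinuousLinearEquiv :
      L2 N (diracDim N) →L[ℂ] L2 N (diracDim N)).restrictScalars ℝ).hasFDerivAt.comp_hasDerivAt
        (0 : ℝ) h1
    convert! h2 using 1
    change _ = (Lp.fourierTransformₗᵢ (Pos N) (Spin (diracDim N))).symm
      (-Complex.I • (Lp.fourierTransformₗᵢ (Pos N) (Spin (diracDim N))) _)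
    rw [map_smul, LinearIsometryEquiv.symm_apply_apply]
  have h3 : HasDerivAt (fun s => diracGroup D (s - t) u) (-Complex.I • diracOp D u) t := by
    have h := h0
    rw [← sub_self t] at h
    exact h.comp_sub_const t t
  have h4 := ((diracGroup D t).toContinuousLinearMap.restrictScalars ℝ).hasFDerivAt.comp_hasDerivAt
    t h3
  convert! h4 using 1
  · funext s
    change _ = diracGroup D t (diracGroup D (s - t) u)
    rw [← diracGroup_add, add_sub_cancel]
  · exact (map_smul (diracGroup D t) _ _).symm

end

end FreeDirac

open FreeDirac

/-! The operator H is symmetric and of first order, so a weight can be carried through the evolution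
at the price of a commutator of order zero. The weight ⟨x⟩ⁿ is unbounded on L², and sup norms are
not adapted to energy estimates. Both difficulties are met by the family w_z(x) = ⟨x⟩ⁿ⟨x - z⟩⁻ⁿ, z ∈
ℝ^N (`locWeight`). Each w_z is smooth and bounded, and its derivatives are at most constants times
w_z itself, with constants independent of z (`exists_symbolBounded_locWeight`). Hence [H, w_z] = -i
∑ₗ (∂ₗ w_z) γₗ is dominated by w_z. Differentiating ‖w_z e^{-itH}u‖² and applying Gronwall gives
‖w_z e^{-itH}u‖ ≤ e^{c|t|}‖w_z u‖ in L², with c independent of z (`norm_locOp_diracGroup_le`). The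
mean value inequality then bounds ‖w_z(e^{-itH}u - u)‖ by |t| e^{c|t|}‖w_z Hu‖
(`norm_locOp_diracGroup_sub_le`).

The norm of 𝒳_d is compared with these localised quantities. Put M = ∫⟨x⟩^{-2n} dx, finite since n >
N/2. By Tonelli, ∫‖w_z f‖² dz = M‖⟨x⟩ⁿf‖² in L² (`lintegral_enorm_locOp_sq`), so the energy estimate
passes to the weighted L² norm. Moreover ‖w_z f‖ is at most M^{1/2}‖⟨x⟩ⁿf‖_{L^∞} and at most
‖⟨x⟩ⁿf‖_{L²}, so the norm of 𝒳_d controls w_z D^β u in L² for all |β| ≤ J, uniformly in z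
(`SpaceX.norm_locOp_weakDeriv_le`). Conversely w_z is comparable to ⟨x⟩ⁿ on |x - z| ≤ 1, and the
Sobolev embedding of order k > N/2 for w_z D^β u returns a weighted sup bound
(`exists_wNorm_top_le`). This costs k derivatives, so it is available for |β| ≤ 2m + 2 = J - k; the
difference e^{-itH}Ψ - Ψ costs one more, which is affordable for |β| ≤ 2m.

Continuity in time of the sup norms follows from the difference estimate. For the weighted L² norms
it follows from dominated convergence in z. On |t| ≤ 1 the exponential is bounded by a constant,
which gives the stated inequalities. -/

namespace FreeDirac

/-! ### Weak derivatives and Sobolev spaces on the Fourier side. -/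

noncomputable section

/-- Multiplication by a function of temperate growth, for distributions given by `L²` functions. -/
theorem smulLeftCLM_toTempered_eq_iff {N d : ℕ} {φ : Pos N → ℂ} (hφ : φ.HasTemperateGrowth)
    {u g : L2 N d} :
    smulLeftCLM (Spin d) φ (u : 𝓢'(Pos N, Spin d)) = (g : 𝓢'(Pos N, Spin d)) ↔
      g =ᵐ[volume] fun x => φ x • u x := by
  have happ : ∀ f : 𝓢(Pos N, ℂ),
      (smulLeftCLM (Spin d) φ (u : 𝓢'(Pos N, Spin d))) f = ∫ x, (φ x * f x) • u x := fun f => by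
    rw [TemperedDistribution.smulLeftCLM_apply_apply, Lp.toTemperedDistribution_apply]
    refine integral_congr_ae (Filter.Eventually.of_forall fun x => ?_)
    simp only []
    rw [SchwartzMap.smulLeftCLM_apply_apply hφ]
    rfl
  constructor
  · intro h
    have hloc : LocallyIntegrable u volume := (Lp.memLp u).locallyIntegrable one_le_two
    refine ae_eq_of_integral_contDiff_smul_eq
      ((Lp.memLp _).locallyIntegrable one_le_two) ?_ ?_
    · rw [← locallyIntegrableOn_univ] at hloc ⊢
      exact hloc.continuousOn_smul isOpen_univ.isLocallyClosed hφ.1.continuous.continuousOn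
    intro f f_smooth f_cpt
    have hf₁ : HasCompactSupport (Complex.ofRealCLM ∘ f) := f_cpt.comp_left rfl
    have hf₂ : ContDiff ℝ ((⊤ : ℕ∞) : WithTop ℕ∞) (Complex.ofRealCLM ∘ f) := by fun_prop
    have h3 := congrArg (fun T : 𝓢'(Pos N, Spin d) => T (hf₁.toSchwartzMap hf₂)) h
    rw [happ, Lp.toTemperedDistribution_apply] at h3
    calc ∫ x, f x • g x = ∫ x, (hf₁.toSchwartzMap hf₂) x • g x := by
          refine integral_congr_ae (Filter.Eventually.of_forall fun x => ?_)
          exact (Complex.coe_smul (f x) _).symm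
      _ = _ := h3.symm
      _ = _ := by
          refine integral_congr_ae (Filter.Eventually.of_forall fun x => ?_)
          simp only []
          rw [← Complex.coe_smul (f x), smul_smul, mul_comm]
          rfl
  · intro h
    ext f
    rw [happ, Lp.toTemperedDistribution_apply]
    refine congrArg (fun v : Spin d => v.ofLp _) (integral_congr_ae ?_)
    filter_upwards [h] with x hx
    rw [hx, smul_smul, mul_comm]

/-- The Fourier symbol `∏ᵢ (2π i ξᵢ)^{βᵢ}` of `D^β`. -/
def derivSymbol {N : ℕ} (β : Fin N → ℕ) (ξ : Pos N) : ℂ :=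
  ∏ i, (2 * Real.pi * Complex.I * (ξ i : ℂ)) ^ β i

theorem hasTemperateGrowth_coord {N : ℕ} (i : Fin N) :
    (fun ξ : Pos N => 2 * Real.pi * Complex.I * (ξ i : ℂ)).HasTemperateGrowth := by
  have h : (fun ξ : Pos N => 2 * Real.pi * Complex.I * (ξ i : ℂ)) =
      fun ξ : Pos N => 2 * Real.pi * Complex.I *
        ((inner ℝ ξ (EuclideanSpace.single i (1 : ℝ)) : ℝ) : ℂ) := by
    funext ξ
    rw [EuclideanSpace.inner_single_right]
    simp
  rw [h]
  fun_prop

theorem hasTemperateGrowth_derivSymbol_list {N : ℕ} (β : Fin N → ℕ) (l : List (Fin N)) :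
    (fun ξ : Pos N => (l.map fun i => (2 * Real.pi * Complex.I * (ξ i : ℂ)) ^ β i).prod
      ).HasTemperateGrowth := by
  induction l with
  | nil => simp [Function.HasTemperateGrowth.const]
  | cons i l ih =>
    simp only [List.map_cons, List.prod_cons]
    exact ((hasTemperateGrowth_coord i).pow (β i)).mul ih

theorem derivSymbol_eq_list {N : ℕ} (β : Fin N → ℕ) (ξ : Pos N) :
    derivSymbol β ξ = ((List.finRange N).map fun i =>
      (2 * Real.pi * Complex.I * (ξ i : ℂ)) ^ β i).prod := by
  rw [derivSymbol, ← List.ofFn_eq_map, List.prod_ofFn]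

theorem hasTemperateGrowth_derivSymbol {N : ℕ} (β : Fin N → ℕ) :
    (derivSymbol β : Pos N → ℂ).HasTemperateGrowth := by
  rw [show (derivSymbol β : Pos N → ℂ) = _ from funext (derivSymbol_eq_list β)]
  exact hasTemperateGrowth_derivSymbol_list β _

theorem derivSymbol_add {N : ℕ} (β γ : Fin N → ℕ) (ξ : Pos N) :
    derivSymbol (β + γ) ξ = derivSymbol β ξ * derivSymbol γ ξ := by
  simp only [derivSymbol, Pi.add_apply, pow_add, Finset.prod_mul_distrib]

theorem derivSymbol_single {N : ℕ} (i : Fin N) (b : ℕ) (ξ : Pos N) :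
    derivSymbol (Pi.single i b) ξ = (2 * Real.pi * Complex.I * (ξ i : ℂ)) ^ b := by
  rw [derivSymbol, Finset.prod_eq_single i]
  · simp
  · intro j _ hj
    simp [hj]
  · simp

theorem fourier_lineDeriv_single {N d : ℕ} (i : Fin N) (T : 𝓢'(Pos N, Spin d)) :
    𝓕 (∂_{EuclideanSpace.single i (1 : ℝ)} T) =
      smulLeftCLM (Spin d) (fun ξ : Pos N => 2 * Real.pi * Complex.I * (ξ i : ℂ)) (𝓕 T) := by
  rw [TemperedDistribution.fourier_lineDerivOp_eq]
  have htg : (fun x : Pos N =>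
      ((inner ℝ x (EuclideanSpace.single i (1 : ℝ)) : ℝ) : ℂ)).HasTemperateGrowth := by fun_prop
  have h := congrArg (fun A : 𝓢'(Pos N, Spin d) →L[ℂ] 𝓢'(Pos N, Spin d) => A (𝓕 T))
    (TemperedDistribution.smulLeftCLM_smul (F := Spin d) htg (2 * Real.pi * Complex.I))
  refine (Eq.trans ?_ h.symm).trans ?_
  · rfl
  · simp only []
    congr 2
    funext ξ
    simp only [Pi.smul_apply, EuclideanSpace.inner_single_right, smul_eq_mul]
    simp

theorem fourier_lineDeriv_single_pow {N d : ℕ} (i : Fin N) (b : ℕ) (T : 𝓢'(Pos N, Spin d)) :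
    𝓕 (((lineDerivOpCLM ℂ 𝓢'(Pos N, Spin d) (EuclideanSpace.single i (1 : ℝ))) ^ b) T) =
      smulLeftCLM (Spin d) (fun ξ : Pos N => (2 * Real.pi * Complex.I * (ξ i : ℂ)) ^ b) (𝓕 T) := by
  induction b with
  | zero => simp
  | succ b ih =>
    rw [pow_succ', mul_apply_eq_comp]
    refine (fourier_lineDeriv_single i _).trans ?_
    rw [ih]
    refine (smulLeftCLM_smulLeftCLM_apply ((hasTemperateGrowth_coord i).pow b)
      (hasTemperateGrowth_coord i) _).trans ?_
    congr 2

theorem fourier_multiDeriv {N d : ℕ} (β : Fin N → ℕ) (T : 𝓢'(Pos N, Spin d)) :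
    𝓕 (multiDeriv β T) = smulLeftCLM (Spin d) (derivSymbol β) (𝓕 T) := by
  have key : ∀ l : List (Fin N),
      𝓕 ((l.map fun i : Fin N => (lineDerivOpCLM ℂ 𝓢'(Pos N, Spin d)
        (EuclideanSpace.single i (1 : ℝ))) ^ β i).prod T) =
      smulLeftCLM (Spin d) (fun ξ : Pos N =>
        (l.map fun i => (2 * Real.pi * Complex.I * (ξ i : ℂ)) ^ β i).prod) (𝓕 T) := by
    intro l
    induction l with
    | nil => simp
    | cons i l ih =>
      rw [List.map_cons, List.prod_cons, mul_apply_eq_comp,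
        fourier_lineDeriv_single_pow, ih]
      refine (smulLeftCLM_smulLeftCLM_apply (hasTemperateGrowth_derivSymbol_list β l)
        ((hasTemperateGrowth_coord i).pow (β i)) _).trans ?_
      congr 2
      funext ξ
      simp [mul_comm]
  rw [show (derivSymbol β : Pos N → ℂ) = _ from funext (derivSymbol_eq_list β), ← key,
    multiDeriv, List.ofFn_eq_map]

/-- Injectivity of the Fourier transform on tempered distributions turns an identity of
distributions into an almost everywhere identity of functions. Commutation and composition of weak
derivatives thereby become pointwise algebra. -/
theorem multiDeriv_eq_iff {N d : ℕ} {β : Fin N → ℕ} {u g : L2 N d} :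
    multiDeriv β (u : 𝓢'(Pos N, Spin d)) = (g : 𝓢'(Pos N, Spin d)) ↔
      (𝓕 g : L2 N d) =ᵐ[volume] fun ξ => derivSymbol β ξ • (𝓕 u : L2 N d) ξ := by
  rw [← smulLeftCLM_toTempered_eq_iff (hasTemperateGrowth_derivSymbol β),
    ← Lp.fourier_toTemperedDistribution_eq, ← Lp.fourier_toTemperedDistribution_eq,
    ← fourier_multiDeriv]
  refine ⟨fun h => by rw [h], fun h => ?_⟩
  have := congrArg (fun T : 𝓢'(Pos N, Spin d) => 𝓕⁻ T) h
  simpa using this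

theorem memSobolev_iff_memLp {N d : ℕ} {s : ℝ} {u : L2 N d} :
    MemSobolev s 2 (u : 𝓢'(Pos N, Spin d)) ↔
      MemLp (fun ξ : Pos N => (((1 + ‖ξ‖ ^ 2) ^ (s / 2) : ℝ) : ℂ) • (𝓕 u : L2 N d) ξ) 2 volume := by
  have htg : (fun ξ : Pos N => (((1 + ‖ξ‖ ^ 2) ^ (s / 2) : ℝ) : ℂ)).HasTemperateGrowth := by
    fun_prop
  rw [memSobolev_iff_exists_smulLeftCLM_fourier]
  simp_rw [Lp.fourier_toTemperedDistribution_eq]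
  constructor
  · rintro ⟨f, hf⟩
    exact (memLp_congr_ae ((smulLeftCLM_toTempered_eq_iff htg).1 hf)).1 (Lp.memLp f)
  · intro h
    exact ⟨h.toLp, (smulLeftCLM_toTempered_eq_iff htg).2 h.coeFn_toLp⟩

theorem fourier_weakDeriv {N d : ℕ} {β : Fin N → ℕ} {J : ℕ} (hβ : ∑ i, β i ≤ J) {u : L2 N d}
    (hu : MemSobolev (J : ℝ) 2 (u : 𝓢'(Pos N, Spin d))) :
    (𝓕 (weakDeriv β u) : L2 N d) =ᵐ[volume] fun ξ => derivSymbol β ξ • (𝓕 u : L2 N d) ξ :=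
  multiDeriv_eq_iff.1 (multiDeriv_eq_weakDeriv hβ hu)

theorem memSobolev_weakDeriv {N d : ℕ} {β : Fin N → ℕ} {J r : ℕ} (hβ : ∑ i, β i + r ≤ J)
    {u : L2 N d} (hu : MemSobolev (J : ℝ) 2 (u : 𝓢'(Pos N, Spin d))) :
    MemSobolev (r : ℝ) 2 (weakDeriv β u : 𝓢'(Pos N, Spin d)) := by
  rw [← multiDeriv_eq_weakDeriv (by omega) hu]
  refine (memSobolev_multiDeriv β _ _ hu).mono ?_
  rw [le_sub_iff_add_le, add_comm]
  exact_mod_cast hβ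

theorem weakDeriv_weakDeriv {N d : ℕ} {β γ : Fin N → ℕ} {J : ℕ} (h : ∑ i, β i + ∑ i, γ i ≤ J)
    {u : L2 N d} (hu : MemSobolev (J : ℝ) 2 (u : 𝓢'(Pos N, Spin d))) :
    weakDeriv γ (weakDeriv β u) = weakDeriv (β + γ) u := by
  symm
  refine weakDeriv_eq (multiDeriv_eq_iff.2 ?_)
  filter_upwards [fourier_weakDeriv (by omega) hu (β := β),
    fourier_weakDeriv le_rfl (memSobolev_weakDeriv h hu)] with ξ h1 h2
  rw [h2, h1, smul_smul, derivSymbol_add, mul_comm]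

/-! ### The Dirac group on Sobolev spaces and its strong continuity. -/

section Group

variable {N : ℕ} (D : DiracMatrices N)

theorem fourier_diracGroup (t : ℝ) (u : L2 N (diracDim N)) :
    𝓕 (diracGroup D t u) = diracMul D t (𝓕 u) := by
  rw [diracGroup_apply, FourierTransform.fourier_fourierInv_eq]

theorem coeFn_fourier_diracGroup (t : ℝ) (u : L2 N (diracDim N)) :
    (𝓕 (diracGroup D t u) : L2 N (diracDim N)) =ᵐ[volume]
      fun ξ => expI t (diracSymbol D ξ) ((𝓕 u : L2 N (diracDim N)) ξ) := by
  rw [fourier_diracGroup]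
  exact coeFn_diracMul D t _

/-- The symbol of the group is unitary at each ξ, so |û(ξ)| does not change. -/
theorem memSobolev_diracGroup (t : ℝ) {s : ℝ} {u : L2 N (diracDim N)}
    (hu : MemSobolev s 2 (u : 𝓢'(Pos N, Spin (diracDim N)))) :
    MemSobolev s 2 (diracGroup D t u : 𝓢'(Pos N, Spin (diracDim N))) := by
  rw [memSobolev_iff_memLp] at hu ⊢
  refine hu.congr_norm ?_ ?_
  · have htg : (fun ξ : Pos N => (((1 + ‖ξ‖ ^ 2) ^ (s / 2) : ℝ) : ℂ)).HasTemperateGrowth := by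
      fun_prop
    exact htg.1.continuous.aestronglyMeasurable.smul (Lp.aestronglyMeasurable _)
  · filter_upwards [coeFn_fourier_diracGroup D t u] with ξ h
    rw [h, norm_smul, norm_smul, norm_expI_apply t (diracSymbol_isSelfAdjoint D ξ)]

/-- The symbol of D^β is scalar and therefore commutes with the matrix symbol of the group. -/
theorem weakDeriv_diracGroup (t : ℝ) {β : Fin N → ℕ} {J : ℕ} (hβ : ∑ i, β i ≤ J)
    {u : L2 N (diracDim N)} (hu : MemSobolev (J : ℝ) 2 (u : 𝓢'(Pos N, Spin (diracDim N)))) :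
    weakDeriv β (diracGroup D t u) = diracGroup D t (weakDeriv β u) := by
  refine weakDeriv_eq (multiDeriv_eq_iff.2 ?_)
  filter_upwards [coeFn_fourier_diracGroup D t u, coeFn_fourier_diracGroup D t (weakDeriv β u),
    fourier_weakDeriv hβ hu] with ξ h1 h2 h3
  rw [h2, h3, h1, map_smul]

/-- Schwartz functions, hence `H^s`, are dense in `L²`. -/
theorem dense_memSobolev (N d : ℕ) (s : ℝ) :
    Dense {u : L2 N d | MemSobolev s 2 (u : 𝓢'(Pos N, Spin d))} := by
  refine (SchwartzMap.denseRange_toLpCLM (E := Pos N) (F := Spin d) (μ := volume)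
    (p := 2) ENNReal.ofNat_ne_top).mono ?_
  rintro _ ⟨f, rfl⟩
  change MemSobolev s 2 (f.toLp 2 (volume : Measure (Pos N)) : 𝓢'(Pos N, Spin d))
  rw [Lp.toTemperedDistribution_toLp_eq]
  exact f.memSobolev (s := s) (p := 2)

/-- Orbits of H¹ data are differentiable, and since the group is isometric they approximate the
orbit of u uniformly in t. -/
theorem continuous_diracGroup (u : L2 N (diracDim N)) : Continuous fun t => diracGroup D t u := by
  refine continuous_of_uniform_approx_of_continuous fun V hV => ?_
  obtain ⟨ε, hε, hεV⟩ := Metric.mem_uniformity_dist.1 hV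
  obtain ⟨v, hv, huv⟩ := (dense_memSobolev N (diracDim N) 1).exists_dist_lt u hε
  refine ⟨fun t => diracGroup D t v, continuous_iff_continuousAt.2 fun t =>
    (hasDerivAt_diracGroup D hv t).continuousAt, fun t => hεV ?_⟩
  rw [(diracGroup D t).isometry.dist_eq]
  exact huv

end Group

end

end FreeDirac

namespace FreeDirac

noncomputable section

open scoped ContDiff

/-! ### The weights ⟨x⟩^r and ⟨x⟩ⁿ⟨x - z⟩⁻ⁿ. -/

section Weights

variable {N : ℕ}

/-- The power `⟨x⟩^r`. -/
def jap (r : ℝ) (x : Pos N) : ℝ := (1 + ‖x‖ ^ 2) ^ (r / 2)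

theorem jap_pos (r : ℝ) (x : Pos N) : 0 < jap r x := Real.rpow_pos_of_pos (by positivity) _

theorem jap_add (r s : ℝ) (x : Pos N) : jap (r + s) x = jap r x * jap s x := by
  rw [jap, jap, jap, ← Real.rpow_add (by positivity), add_div]

theorem jap_mono {r s : ℝ} (h : r ≤ s) (x : Pos N) : jap r x ≤ jap s x :=
  Real.rpow_le_rpow_of_exponent_le (by simp) (by linarith)

theorem jap_zero (x : Pos N) : jap 0 x = 1 := by simp [jap]

theorem jap_natCast (n : ℕ) (x : Pos N) : jap n x = bracket x ^ n := by
  rw [jap, bracket, Real.sqrt_eq_rpow, ← Real.rpow_natCast _ n, ← Real.rpow_mul (by positivity)]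
  congr 1
  ring

theorem contDiff_jap (r : ℝ) : ContDiff ℝ ∞ (jap r : Pos N → ℝ) :=
  (Function.hasTemperateGrowth_one_add_norm_sq_rpow (Pos N) (r / 2)).1

theorem norm_le_jap_one (x : Pos N) : ‖x‖ ≤ jap 1 x := by
  rw [jap, ← Real.sqrt_eq_rpow]
  exact Real.le_sqrt_of_sq_le (by simp)

theorem fderiv_jap (r : ℝ) :
    fderiv ℝ (jap r : Pos N → ℝ) = fun x => (r * jap (r - 2) x) • innerSL ℝ x := by
  funext x
  have h1 : HasFDerivAt (fun x : Pos N => 1 + ‖x‖ ^ 2) ((2 : ℝ) • innerSL ℝ x) x := by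
    have := (hasStrictFDerivAt_norm_sq x).hasFDerivAt.const_add (1 : ℝ)
    convert! this using 1
    ext
    simp
  have h2 := h1.rpow_const (p := r / 2) (Or.inl (by positivity))
  refine h2.fderiv.trans ?_
  rw [smul_smul, jap, show (r - 2) / 2 = r / 2 - 1 by ring]
  congr 1
  ring

theorem norm_iteratedFDeriv_clm_le {F : Type*} [NormedAddCommGroup F] [NormedSpace ℝ F]
    (L : Pos N →L[ℝ] F) (i : ℕ) (x : Pos N) : ‖iteratedFDeriv ℝ i L x‖ ≤ ‖L‖ * jap 1 x := by
  have h1 : (1 : ℝ) ≤ jap 1 x := by simpa [jap_zero] using jap_mono zero_le_one x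
  match i with
  | 0 =>
    rw [norm_iteratedFDeriv_zero]
    exact (L.le_opNorm x).trans (by gcongr; exact norm_le_jap_one x)
  | 1 =>
    rw [norm_iteratedFDeriv_one, L.fderiv]
    exact le_mul_of_one_le_right (norm_nonneg _) h1
  | i + 2 =>
    rw [← norm_iteratedFDeriv_fderiv, show fderiv ℝ L = fun _ => L from funext fun _ => L.fderiv,
      iteratedFDeriv_succ_const]
    simpa using mul_nonneg (norm_nonneg L) (zero_le_one.trans h1)

/-- The gradient of ⟨x⟩^r is r⟨x⟩^{r-2}x. By Leibniz and induction, its derivatives are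
O(⟨x⟩^{r-2}⟨x⟩), which is O(⟨x⟩^r). The exponent changes along the induction, hence the quantifier
over r after i. -/
theorem exists_norm_iteratedFDeriv_jap_le (i : ℕ) :
    ∀ r : ℝ, ∃ C : ℝ, ∀ x : Pos N, ‖iteratedFDeriv ℝ i (jap r) x‖ ≤ C * jap r x := by
  induction i using Nat.strong_induction_on with
  | _ i ih =>
    intro r
    match i with
    | 0 =>
      refine ⟨1, fun x => ?_⟩
      rw [norm_iteratedFDeriv_zero, Real.norm_of_nonneg (jap_pos r x).le, one_mul]
    | i + 1 =>
      choose! C hC using fun j (hj : j ≤ i) => ih j (by omega) (r - 2)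
      refine ⟨|r| * ∑ j ∈ Finset.range (i + 1), (i.choose j : ℝ) * C j * ‖innerSL ℝ (E := Pos N)‖,
        fun x => ?_⟩
      rw [← norm_iteratedFDeriv_fderiv, fderiv_jap]
      have h1 : (fun x : Pos N => (r * jap (r - 2) x) • innerSL ℝ x) =
          r • fun x : Pos N => jap (r - 2) x • innerSL ℝ x := by
        funext x
        simp [mul_smul]
      have hs : ContDiff ℝ ∞ fun x : Pos N => innerSL ℝ x := (innerSL ℝ (E := Pos N)).contDiff
      have hsm : ContDiff ℝ ∞ fun x : Pos N => jap (r - 2) x • innerSL ℝ x :=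
        (contDiff_jap (r - 2)).smul hs
      rw [h1, iteratedFDeriv_const_smul_apply ((hsm.of_le (by exact_mod_cast le_top)).contDiffAt),
        norm_smul, Real.norm_eq_abs, mul_assoc]
      refine mul_le_mul_of_nonneg_left ?_ (abs_nonneg r)
      refine (norm_iteratedFDeriv_smul_le (contDiff_jap (r - 2)) hs x
        (n := i) (by exact_mod_cast le_top)).trans ?_
      rw [Finset.sum_mul]
      refine Finset.sum_le_sum fun j hj => ?_
      have hj' : j ≤ i := Nat.lt_succ_iff.1 (Finset.mem_range.1 hj)
      have h2 := hC j hj' x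
      have h3 := norm_iteratedFDeriv_clm_le (innerSL ℝ (E := Pos N)) (i - j) x
      calc (i.choose j : ℝ) * ‖iteratedFDeriv ℝ j (jap (r - 2)) x‖ *
            ‖iteratedFDeriv ℝ (i - j) (fun x : Pos N => innerSL ℝ x) x‖
          ≤ (i.choose j : ℝ) * (C j * jap (r - 2) x) * (‖innerSL ℝ (E := Pos N)‖ * jap 1 x) := by
            have := (norm_nonneg _).trans h2
            gcongr
        _ = (i.choose j : ℝ) * C j * ‖innerSL ℝ (E := Pos N)‖ * jap (r - 2 + 1) x := by
            rw [jap_add]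
            ring
        _ ≤ _ := by
            have : 0 ≤ C j := by
              have := (norm_nonneg _).trans h2
              exact nonneg_of_mul_nonneg_left this (jap_pos _ x)
            gcongr
            exact jap_mono (by linarith) x

/-- A smooth function all of whose derivatives are bounded by multiples of `w`. -/
def SymbolBounded (w : Pos N → ℝ) (K : ℕ → ℝ) (φ : Pos N → ℂ) : Prop :=
  ContDiff ℝ ∞ φ ∧ ∀ i x, ‖iteratedFDeriv ℝ i φ x‖ ≤ K i * w x

theorem SymbolBounded.norm_le {w : Pos N → ℝ} {K : ℕ → ℝ} {φ : Pos N → ℂ}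
    (h : SymbolBounded w K φ) (x : Pos N) : ‖φ x‖ ≤ K 0 * w x := by
  simpa using h.2 0 x

theorem SymbolBounded.fderiv_apply {w : Pos N → ℝ} {K : ℕ → ℝ} {φ : Pos N → ℂ}
    (h : SymbolBounded w K φ) {v : Pos N} (hv : ‖v‖ ≤ 1) :
    SymbolBounded w (fun i => K (i + 1)) fun x => fderiv ℝ φ x v := by
  have hd : ContDiff ℝ ∞ (fderiv ℝ φ) := h.1.fderiv_right (by simp)
  refine ⟨hd.clm_apply contDiff_const, fun i x => ?_⟩
  refine (norm_iteratedFDeriv_clm_apply_const (N := ∞) hd.contDiffAt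
    (by exact_mod_cast le_top)).trans ?_
  rw [norm_iteratedFDeriv_fderiv]
  exact (mul_le_of_le_one_left (norm_nonneg _) hv).trans (h.2 (i + 1) x)

theorem SymbolBounded.hasTemperateGrowth {w : Pos N → ℝ} {K : ℕ → ℝ} {φ : Pos N → ℂ} {B : ℝ}
    (h : SymbolBounded w K φ) (hw : ∀ x, 0 ≤ w x ∧ w x ≤ B) : φ.HasTemperateGrowth := by
  refine ⟨h.1, fun i => ⟨0, |K i| * B, fun x => (h.2 i x).trans ?_⟩⟩
  rw [pow_zero, mul_one]
  exact mul_le_mul (le_abs_self _) (hw x).2 (hw x).1 (abs_nonneg _)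

theorem SymbolBounded.memLp_top {w : Pos N → ℝ} {K : ℕ → ℝ} {φ : Pos N → ℂ} {B : ℝ}
    (h : SymbolBounded w K φ) (hw : ∀ x, 0 ≤ w x ∧ w x ≤ B) : MemLp φ ⊤ volume := by
  refine memLp_top_of_bound h.1.continuous.aestronglyMeasurable (|K 0| * B)
    (Filter.Eventually.of_forall fun x => (h.norm_le x).trans ?_)
  exact mul_le_mul (le_abs_self _) (hw x).2 (hw x).1 (abs_nonneg _)

/-- The weight `⟨x⟩ⁿ ⟨x - z⟩⁻ⁿ`. -/
def locWeight (n : ℕ) (z x : Pos N) : ℝ := jap n x * jap (-n) (x - z)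

theorem locWeight_pos (n : ℕ) (z x : Pos N) : 0 < locWeight n z x :=
  mul_pos (jap_pos _ _) (jap_pos _ _)

theorem contDiff_locWeight (n : ℕ) (z : Pos N) : ContDiff ℝ ∞ (locWeight n z) :=
  (contDiff_jap n).mul ((contDiff_jap (-n)).comp (contDiff_id.sub contDiff_const))

theorem locWeight_le (n : ℕ) (z x : Pos N) : locWeight n z x ≤ bracket x ^ n := by
  rw [← jap_natCast, locWeight]
  refine mul_le_of_le_one_right (jap_pos _ _).le ?_
  simpa [jap_zero] using jap_mono (r := -(n : ℝ)) (s := 0) (by simp) (x - z)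

/-- Peetre's inequality, from |x| ≤ |x - z| + |z|. It makes each weight bounded for fixed z. -/
theorem one_add_norm_sq_le (x z : Pos N) :
    1 + ‖x‖ ^ 2 ≤ 2 * (1 + ‖z‖ ^ 2) * (1 + ‖x - z‖ ^ 2) := by
  have h : ‖x‖ ≤ ‖x - z‖ + ‖z‖ := by simpa using norm_add_le (x - z) z
  nlinarith [norm_nonneg x, norm_nonneg z, norm_nonneg (x - z), sq_nonneg (‖x - z‖ - ‖z‖),
    sq_nonneg (‖x - z‖ * ‖z‖)]

/-- This bound grows with z. It only serves to make multiplication by the weight a bounded operator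
on L², and does not enter the constants of the estimates. -/
theorem locWeight_le_bound (n : ℕ) (z x : Pos N) :
    locWeight n z x ≤ (2 * (1 + ‖z‖ ^ 2)) ^ ((n : ℝ) / 2) := by
  have h : jap n x ≤ (2 * (1 + ‖z‖ ^ 2)) ^ ((n : ℝ) / 2) * jap n (x - z) := by
    rw [jap, jap, ← Real.mul_rpow (by positivity) (by positivity)]
    exact Real.rpow_le_rpow (by positivity) (one_add_norm_sq_le x z) (by positivity)
  calc locWeight n z x
      ≤ (2 * (1 + ‖z‖ ^ 2)) ^ ((n : ℝ) / 2) * jap n (x - z) * jap (-n) (x - z) :=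
        mul_le_mul_of_nonneg_right h (jap_pos _ _).le
    _ = _ := by rw [mul_assoc, ← jap_add, add_neg_cancel, jap_zero, mul_one]

/-- On the unit ball about z the localising factor is at least 2^{-n/2}, so the full weight can be
recovered from a nearby centre. -/
theorem bracket_pow_le_locWeight (n : ℕ) {z x : Pos N} (h : ‖x - z‖ ≤ 1) :
    bracket x ^ n ≤ 2 ^ ((n : ℝ) / 2) * locWeight n z x := by
  rw [← jap_natCast, locWeight]
  have h1 : jap n (x - z) ≤ 2 ^ ((n : ℝ) / 2) := by
    refine Real.rpow_le_rpow (by positivity) ?_ (by positivity)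
    nlinarith [norm_nonneg (x - z)]
  have h2 : jap n (x - z) * jap (-n) (x - z) = 1 := by
    rw [← jap_add, add_neg_cancel, jap_zero]
  calc jap n x = jap n x * (jap n (x - z) * jap (-n) (x - z)) := by rw [h2, mul_one]
    _ ≤ jap n x * (2 ^ ((n : ℝ) / 2) * jap (-n) (x - z)) := by
        have := (jap_pos n x).le
        have := (jap_pos (-n) (x - z)).le
        gcongr
    _ = _ := by ring

/-- The weights `⟨x⟩ⁿ ⟨x - z⟩⁻ⁿ` bound their own derivatives, uniformly in `z`. -/
theorem exists_symbolBounded_locWeight (N n : ℕ) : ∃ K : ℕ → ℝ, ∀ z : Pos N,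
    SymbolBounded (locWeight n z) K fun x => (locWeight n z x : ℂ) := by
  choose A hA using fun i => exists_norm_iteratedFDeriv_jap_le (N := N) i n
  choose B hB using fun i => exists_norm_iteratedFDeriv_jap_le (N := N) i (-n)
  refine ⟨fun i => ∑ j ∈ Finset.range (i + 1), (i.choose j : ℝ) * A j * B (i - j), fun z =>
    ⟨Complex.ofRealCLM.contDiff.comp (contDiff_locWeight n z), fun i x => ?_⟩⟩
  have h1 : ‖iteratedFDeriv ℝ i (fun x => (locWeight n z x : ℂ)) x‖ =
      ‖iteratedFDeriv ℝ i (locWeight n z) x‖ :=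
    Complex.ofRealLI.norm_iteratedFDeriv_comp_left
      ((contDiff_locWeight n z).contDiffAt (x := x)) (by exact_mod_cast le_top)
  rw [h1]
  have hc : ContDiff ℝ ∞ fun x : Pos N => jap (-n) (x - z) :=
    (contDiff_jap (-n)).comp (contDiff_id.sub contDiff_const)
  refine (norm_iteratedFDeriv_mul_le (contDiff_jap n) hc x (n := i)
    (by exact_mod_cast le_top)).trans ?_
  rw [Finset.sum_mul]
  refine Finset.sum_le_sum fun j _ => ?_
  -- Derivatives of a translate are translates of derivatives: this is why the constants do not
  -- depend on z.
  rw [iteratedFDeriv_comp_sub]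
  have h2 := hA j x
  have h3 := hB (i - j) (x - z)
  have := (norm_nonneg _).trans h2
  calc _ ≤ (i.choose j : ℝ) * (A j * jap n x) * (B (i - j) * jap (-n) (x - z)) := by gcongr
    _ = _ := by rw [locWeight]; ring

theorem lintegral_jap_neg_lt_top {n : ℕ} (hn : (N : ℝ) / 2 < n) :
    ∫⁻ x : Pos N, ENNReal.ofReal (jap (-n) x) ^ 2 < ⊤ := by
  have h := (integrable_rpow_neg_one_add_norm_sq (E := Pos N) (μ := volume) (r := 2 * n)
    (by rw [finrank_euclideanSpace, Fintype.card_fin]; linarith)).lintegral_lt_top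
  refine lt_of_le_of_lt (lintegral_mono fun x => le_of_eq ?_) h
  rw [← ENNReal.ofReal_pow (jap_pos _ _).le, jap, ← Real.rpow_natCast, ← Real.rpow_mul
    (by positivity)]
  congr 2
  push_cast
  ring

end Weights

end

end FreeDirac

namespace FreeDirac

noncomputable section

/-! ### Multiplication operators on L² and the Leibniz rule. -/

section Multiplication

variable {N d : ℕ}

/-- Multiplication by a bounded function on `L²`. -/
def mulOp (φ : Pos N → ℂ) (hφ : MemLp φ ∞ volume) : L2 N d →L[ℂ] L2 N d :=
  (ContinuousLinearMap.lsmul ℂ ℂ : ℂ →L[ℂ] Spin d →L[ℂ] Spin d).holderL volume ∞ 2 2 (hφ.toLp φ)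

theorem coeFn_mulOp (φ : Pos N → ℂ) (hφ : MemLp φ ∞ volume) (u : L2 N d) :
    mulOp φ hφ u =ᵐ[volume] fun x => φ x • u x := by
  filter_upwards [(ContinuousLinearMap.lsmul ℂ ℂ : ℂ →L[ℂ] Spin d →L[ℂ] Spin d).coeFn_holder
    (r := 2) (hφ.toLp φ) u, hφ.coeFn_toLp] with x h1 h2
  refine h1.trans ?_
  rw [h2]
  rfl

theorem norm_mulOp_le {φ ψ : Pos N → ℂ} {hφ : MemLp φ ∞ volume} {hψ : MemLp ψ ∞ volume} {c : ℝ}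
    (h : ∀ x, ‖φ x‖ ≤ c * ‖ψ x‖) (u : L2 N d) : ‖mulOp φ hφ u‖ ≤ c * ‖mulOp ψ hψ u‖ := by
  refine Lp.norm_le_mul_norm_of_ae_le_mul ?_
  filter_upwards [coeFn_mulOp φ hφ u, coeFn_mulOp ψ hψ u] with x h1 h2
  rw [h1, h2, norm_smul, norm_smul, ← mul_assoc]
  exact mul_le_mul_of_nonneg_right (h x) (norm_nonneg _)

theorem toTempered_mulOp {φ : Pos N → ℂ} (hφ : MemLp φ ∞ volume) (hg : φ.HasTemperateGrowth)
    (u : L2 N d) :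
    (mulOp φ hφ u : 𝓢'(Pos N, Spin d)) = smulLeftCLM (Spin d) φ (u : 𝓢'(Pos N, Spin d)) :=
  ((smulLeftCLM_toTempered_eq_iff hg).2 (coeFn_mulOp φ hφ u)).symm

theorem mulOp_compLp {φ : Pos N → ℂ} (hφ : MemLp φ ∞ volume) (A : Spin d →L[ℂ] Spin d)
    (u : L2 N d) : mulOp φ hφ (A.compLp u) = A.compLp (mulOp φ hφ u) := by
  ext1
  filter_upwards [coeFn_mulOp φ hφ (A.compLp u), A.coeFn_compLp u, A.coeFn_compLp (mulOp φ hφ u),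
    coeFn_mulOp φ hφ u] with x h1 h2 h3 h4
  rw [h1, h2, h3, h4, map_smul]

/-- By duality this is the Leibniz rule for φ f with f a Schwartz function. -/
theorem lineDerivOp_smulLeftCLM {φ : Pos N → ℂ} (hφ : φ.HasTemperateGrowth) {v : Pos N}
    (hφ' : (fun x => fderiv ℝ φ x v).HasTemperateGrowth) (T : 𝓢'(Pos N, Spin d)) :
    ∂_{v} (smulLeftCLM (Spin d) φ T) =
      smulLeftCLM (Spin d) (fun x => fderiv ℝ φ x v) T + smulLeftCLM (Spin d) φ (∂_{v} T) := by
  have key : ∀ f : 𝓢(Pos N, ℂ), SchwartzMap.smulLeftCLM ℂ φ (-∂_{v} f) =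
      SchwartzMap.smulLeftCLM ℂ (fun x => fderiv ℝ φ x v) f +
        -∂_{v} (SchwartzMap.smulLeftCLM ℂ φ f) := by
    intro f
    ext x
    have h1 : HasFDerivAt (fun y => φ y • f y) (φ x • fderiv ℝ f x +
        (fderiv ℝ φ x).smulRight (f x)) x :=
      (hφ.1.differentiable (by simp) x).hasFDerivAt.smul f.differentiableAt.hasFDerivAt
    have h2 : (SchwartzMap.smulLeftCLM ℂ φ f : Pos N → ℂ) = fun y => φ y • f y := by
      funext y
      exact SchwartzMap.smulLeftCLM_apply_apply hφ f y
    rw [SchwartzMap.smulLeftCLM_apply_apply hφ, add_apply,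
      SchwartzMap.smulLeftCLM_apply_apply hφ', neg_apply, neg_apply,
      SchwartzMap.lineDerivOp_apply_eq_fderiv, SchwartzMap.lineDerivOp_apply_eq_fderiv, h2,
      h1.fderiv]
    simp
  ext1 f
  change T (SchwartzMap.smulLeftCLM ℂ φ (-∂_{v} f)) =
    T (SchwartzMap.smulLeftCLM ℂ (fun x => fderiv ℝ φ x v) f) +
      T (-∂_{v} (SchwartzMap.smulLeftCLM ℂ φ f))
  rw [key, map_add]

theorem multiDeriv_single_mulOp {φ : Pos N → ℂ} (hφ : MemLp φ ∞ volume)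
    (hg : φ.HasTemperateGrowth) {l : Fin N}
    (hφ' : MemLp (fun x => fderiv ℝ φ x (EuclideanSpace.single l (1 : ℝ))) ∞ volume)
    (hg' : (fun x => fderiv ℝ φ x (EuclideanSpace.single l (1 : ℝ))).HasTemperateGrowth)
    {u : L2 N d} (hu : MemSobolev 1 2 (u : 𝓢'(Pos N, Spin d))) :
    multiDeriv (Pi.single l 1) (mulOp φ hφ u : 𝓢'(Pos N, Spin d)) =
      (mulOp _ hφ' u + mulOp φ hφ (weakDeriv (Pi.single l 1) u) : L2 N d) := by
  rw [toTempered_add, toTempered_mulOp hφ hg, toTempered_mulOp hφ' hg', toTempered_mulOp hφ hg,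
    ← multiDeriv_eq_weakDeriv (J := 1) (by simp) (by simpa using hu), multiDeriv_single,
    multiDeriv_single, lineDerivOp_smulLeftCLM hg hg']

theorem multiDeriv_single_add (l : Fin N) (a b : ℕ) (T : 𝓢'(Pos N, Spin d)) :
    multiDeriv (Pi.single l (a + b)) T = multiDeriv (Pi.single l a) (multiDeriv (Pi.single l b) T) := by
  have h : 𝓕 (multiDeriv (Pi.single l (a + b)) T) =
      𝓕 (multiDeriv (Pi.single l a) (multiDeriv (Pi.single l b) T)) := by
    rw [fourier_multiDeriv, fourier_multiDeriv, fourier_multiDeriv, smulLeftCLM_smulLeftCLM_apply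
      (hasTemperateGrowth_derivSymbol _) (hasTemperateGrowth_derivSymbol _)]
    congr 2
    funext ξ
    rw [Pi.mul_apply, derivSymbol_single, derivSymbol_single, derivSymbol_single, pow_add, mul_comm]
  have := congrArg (fun T : 𝓢'(Pos N, Spin d) => 𝓕⁻ T) h
  simpa using this

theorem norm_coord_le_derivSymbol (l : Fin N) (ξ : Pos N) :
    |ξ l| ≤ ‖derivSymbol (Pi.single l 1) ξ‖ := by
  rw [derivSymbol_single, pow_one, norm_mul, norm_mul, norm_mul, Complex.norm_I, Complex.norm_real,
    Complex.norm_real, Complex.norm_ofNat, Real.norm_eq_abs, Real.norm_eq_abs,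
    abs_of_pos Real.pi_pos]
  nlinarith [Real.pi_gt_three, abs_nonneg (ξ l)]

/-- Since ⟨ξ⟩ ≤ 1 + ∑ₗ |ξₗ|, the function ⟨ξ⟩û is dominated by |û| and the transforms of the first
derivatives. -/
theorem memSobolev_one_of_weakDeriv {u : L2 N d} (g : Fin N → L2 N d)
    (hg : ∀ l, multiDeriv (Pi.single l 1) (u : 𝓢'(Pos N, Spin d)) = (g l : 𝓢'(Pos N, Spin d))) :
    MemSobolev 1 2 (u : 𝓢'(Pos N, Spin d)) := by
  rw [memSobolev_iff_memLp]
  have htg : (fun ξ : Pos N => (((1 + ‖ξ‖ ^ 2) ^ ((1 : ℝ) / 2) : ℝ) : ℂ)).HasTemperateGrowth := by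
    fun_prop
  have h1 : MemLp (fun ξ => ‖(𝓕 u : L2 N d) ξ‖ + ∑ l, ‖(𝓕 (g l) : L2 N d) ξ‖) 2 volume :=
    (Lp.memLp _).norm.add (memLp_finsetSum _ fun l _ => (Lp.memLp (𝓕 (g l) : L2 N d)).norm)
  refine h1.mono (htg.1.continuous.aestronglyMeasurable.smul (Lp.aestronglyMeasurable _)) ?_
  have h2 : ∀ᵐ ξ : Pos N, ∀ l, (𝓕 (g l) : L2 N d) ξ =
      derivSymbol (Pi.single l 1) ξ • (𝓕 u : L2 N d) ξ :=
    ae_all_iff.2 fun l => multiDeriv_eq_iff.1 (hg l)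
  filter_upwards [h2] with ξ h
  rw [Real.norm_of_nonneg (by positivity), norm_smul, Complex.norm_real,
    Real.norm_of_nonneg (by positivity), ← Real.sqrt_eq_rpow]
  have h3 : Real.sqrt (1 + ‖ξ‖ ^ 2) ≤ 1 + ∑ l, |ξ l| := by
    rw [EuclideanSpace.norm_sq_eq]
    refine Real.sqrt_le_iff.2 ⟨by positivity, ?_⟩
    have h4 : ∑ l, ‖ξ l‖ ^ 2 ≤ (∑ l, |ξ l|) ^ 2 :=
      Finset.sum_sq_le_sq_sum_of_nonneg fun l _ => abs_nonneg _
    have : 0 ≤ ∑ l, |ξ l| := by positivity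
    nlinarith
  calc Real.sqrt (1 + ‖ξ‖ ^ 2) * ‖(𝓕 u : L2 N d) ξ‖
      ≤ (1 + ∑ l, |ξ l|) * ‖(𝓕 u : L2 N d) ξ‖ := by gcongr
    _ = ‖(𝓕 u : L2 N d) ξ‖ + ∑ l, |ξ l| * ‖(𝓕 u : L2 N d) ξ‖ := by
        rw [add_mul, one_mul, Finset.sum_mul]
    _ ≤ _ := by
        gcongr with l
        rw [h l, norm_smul]
        gcongr
        exact norm_coord_le_derivSymbol l ξ

end Multiplication

end

end FreeDirac

namespace FreeDirac

noncomputable section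

/-! ### Multiplication by the localised weights. -/

section LocOp

variable {N d : ℕ}

/-- Constants bounding the derivatives of the weights `⟨x⟩ⁿ ⟨x - z⟩⁻ⁿ`. -/
def weightConst (N n : ℕ) : ℕ → ℝ := (exists_symbolBounded_locWeight N n).choose

theorem symbolBounded_locWeight (n : ℕ) (z : Pos N) :
    SymbolBounded (locWeight n z) (weightConst N n) fun x => (locWeight n z x : ℂ) :=
  (exists_symbolBounded_locWeight N n).choose_spec z

theorem locWeight_mem (n : ℕ) (z x : Pos N) :
    0 ≤ locWeight n z x ∧ locWeight n z x ≤ (2 * (1 + ‖z‖ ^ 2)) ^ ((n : ℝ) / 2) :=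
  ⟨(locWeight_pos n z x).le, locWeight_le_bound n z x⟩

theorem SymbolBounded.memLp {n : ℕ} {z : Pos N} {K : ℕ → ℝ} {φ : Pos N → ℂ}
    (h : SymbolBounded (locWeight n z) K φ) : MemLp φ ∞ volume :=
  h.memLp_top (locWeight_mem n z)

theorem SymbolBounded.temperate {n : ℕ} {z : Pos N} {K : ℕ → ℝ} {φ : Pos N → ℂ}
    (h : SymbolBounded (locWeight n z) K φ) : φ.HasTemperateGrowth :=
  h.hasTemperateGrowth (locWeight_mem n z)

/-- Multiplication by `⟨x⟩ⁿ ⟨x - z⟩⁻ⁿ` on `L²`. -/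
def locOp (n : ℕ) (z : Pos N) : L2 N d →L[ℂ] L2 N d :=
  mulOp (fun x => (locWeight n z x : ℂ)) (symbolBounded_locWeight n z).memLp

theorem coeFn_locOp (n : ℕ) (z : Pos N) (u : L2 N d) :
    locOp n z u =ᵐ[volume] fun x => (locWeight n z x : ℂ) • u x :=
  coeFn_mulOp _ _ _

theorem SymbolBounded.norm_mulOp_le {n : ℕ} {z : Pos N} {K : ℕ → ℝ} {φ : Pos N → ℂ}
    (h : SymbolBounded (locWeight n z) K φ) (u : L2 N d) :
    ‖mulOp φ h.memLp u‖ ≤ K 0 * ‖locOp n z u‖ := by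
  refine FreeDirac.norm_mulOp_le (fun x => ?_) u
  rw [Complex.norm_real, Real.norm_of_nonneg (locWeight_pos n z x).le]
  exact h.norm_le x

theorem norm_single_one_le (l : Fin N) : ‖(EuclideanSpace.single l (1 : ℝ) : Pos N)‖ ≤ 1 := by
  simp

theorem norm_compLp_le (A : Spin d →L[ℂ] Spin d) (u : L2 N d) : ‖A.compLp u‖ ≤ ‖A‖ * ‖u‖ :=
  A.norm_compLp_le u

end LocOp

/-! ### Weighted energy estimates, uniform in the centre. -/

section Energy

variable {N : ℕ} (D : DiracMatrices N)

/-- The constant `∑ₗ ‖γₗ‖ + ‖η‖`. -/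
def matConst : ℝ := ∑ l, ‖matCLM (D.γ l)‖ + ‖matCLM D.η‖

theorem matConst_nonneg : 0 ≤ matConst D := by
  unfold matConst
  positivity

theorem sum_norm_le_matConst : ∑ l, ‖matCLM (D.γ l)‖ ≤ matConst D := by
  unfold matConst
  linarith [norm_nonneg (matCLM D.η)]

theorem weightConst_one_nonneg (N n : ℕ) : 0 ≤ weightConst N n 1 := by
  have h := (norm_nonneg _).trans ((symbolBounded_locWeight (N := N) n 0).2 1 0)
  exact nonneg_of_mul_nonneg_left h (locWeight_pos n 0 0)

/-- The weighted function must stay in the domain of H for the symmetry of H to apply to it. -/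
theorem memSobolev_locOp {d : ℕ} (n : ℕ) (z : Pos N) {u : L2 N d}
    (hu : MemSobolev 1 2 (u : 𝓢'(Pos N, Spin d))) :
    MemSobolev 1 2 (locOp n z u : 𝓢'(Pos N, Spin d)) :=
  memSobolev_one_of_weakDeriv _ fun l =>
    multiDeriv_single_mulOp _ (symbolBounded_locWeight n z).temperate
      ((symbolBounded_locWeight n z).fderiv_apply (norm_single_one_le l)).memLp
      ((symbolBounded_locWeight n z).fderiv_apply (norm_single_one_le l)).temperate hu

/-- The commutator of H with the weight is multiplication by -i ∑ₗ (∂ₗ w_z) γₗ, and |∂ₗ w_z| is at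
most a constant times w_z. Bounding it by the weight itself, not by a constant, is what closes the
Gronwall argument uniformly in z. -/
theorem norm_diracOp_locOp_sub_le (n : ℕ) (z : Pos N) {u : L2 N (diracDim N)}
    (hu : MemSobolev 1 2 (u : 𝓢'(Pos N, Spin (diracDim N)))) :
    ‖diracOp D (locOp n z u) - locOp n z (diracOp D u)‖ ≤
      matConst D * weightConst N n 1 * ‖locOp n z u‖ := by
  have hb := fun l : Fin N => (symbolBounded_locWeight n z).fderiv_apply (norm_single_one_le l)
  have h1 : ∀ l, weakDeriv (Pi.single l 1) (locOp n z u) =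
      mulOp _ (hb l).memLp u + locOp n z (weakDeriv (Pi.single l 1) u) := fun l =>
    weakDeriv_eq (multiDeriv_single_mulOp _ (symbolBounded_locWeight n z).temperate (hb l).memLp
      (hb l).temperate hu)
  have h2 : diracOp D (locOp n z u) - locOp n z (diracOp D u) =
      -Complex.I • ∑ l, (matCLM (D.γ l)).compLp (mulOp _ (hb l).memLp u) := by
    have h3 : ∀ (A : Spin (diracDim N) →L[ℂ] Spin (diracDim N)) (v : L2 N (diracDim N)),
        locOp n z (A.compLp v) = A.compLp (locOp n z v) := fun A v => mulOp_compLp _ A v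
    have h4 : ∀ (A : Spin (diracDim N) →L[ℂ] Spin (diracDim N)) (v w : L2 N (diracDim N)),
        A.compLp (v + w) = A.compLp v + A.compLp w := fun A v w =>
      (A.compLpₗ 2 volume).map_add v w
    simp only [diracOp, h1, map_add, map_smul, map_sum, h3, h4, Finset.sum_add_distrib, smul_add]
    abel
  rw [h2, norm_smul, norm_neg, Complex.norm_I, one_mul]
  calc ‖∑ l, (matCLM (D.γ l)).compLp (mulOp _ (hb l).memLp u)‖
      ≤ ∑ l, ‖matCLM (D.γ l)‖ * (weightConst N n 1 * ‖locOp n z u‖) := by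
        refine norm_sum_le_of_le _ fun l _ => (norm_compLp_le _ _).trans ?_
        gcongr
        exact (hb l).norm_mulOp_le u
    _ = (∑ l, ‖matCLM (D.γ l)‖) * (weightConst N n 1 * ‖locOp n z u‖) := by rw [Finset.sum_mul]
    _ ≤ matConst D * (weightConst N n 1 * ‖locOp n z u‖) := by
        have := weightConst_one_nonneg N n
        gcongr
        exact sum_norm_le_matConst D
    _ = _ := by ring

theorem norm_locOp_diracOp_le (n : ℕ) (z : Pos N) (u : L2 N (diracDim N)) :
    ‖locOp n z (diracOp D u)‖ ≤ matConst D *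
      (∑ l, ‖locOp n z (weakDeriv (Pi.single l 1) u)‖ + ‖locOp n z u‖) := by
  have h3 : ∀ (A : Spin (diracDim N) →L[ℂ] Spin (diracDim N)) (v : L2 N (diracDim N)),
      locOp n z (A.compLp v) = A.compLp (locOp n z v) := fun A v => mulOp_compLp _ A v
  rw [diracOp, map_add, map_smul, map_sum, h3]
  simp only [h3]
  refine (norm_add_le _ _).trans ?_
  rw [norm_smul, norm_neg, Complex.norm_I, one_mul, mul_add]
  refine add_le_add ?_ ((norm_compLp_le _ _).trans ?_)
  · rw [Finset.mul_sum]
    refine norm_sum_le_of_le _ fun l _ => (norm_compLp_le _ _).trans ?_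
    gcongr
    exact (Finset.single_le_sum (f := fun l => ‖matCLM (D.γ l)‖) (fun _ _ => norm_nonneg _)
      (Finset.mem_univ l)).trans (sum_norm_le_matConst D)
  · gcongr
    unfold matConst
    have : 0 ≤ ∑ l, ‖matCLM (D.γ l)‖ := by positivity
    linarith

theorem hasDerivAt_norm_sq_of_hasDerivAt {V : Type*} [NormedAddCommGroup V]
    [InnerProductSpace ℂ V] {f : ℝ → V} {f' : V} {t : ℝ} (hf : HasDerivAt f f' t) :
    HasDerivAt (fun s => ‖f s‖ ^ 2) (2 * (inner ℂ (f t) f').re) t := by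
  have h := Complex.reCLM.hasFDerivAt.comp_hasDerivAt t (hf.inner ℂ hf)
  convert! h using 1
  · funext s
    simpa using (inner_self_eq_norm_sq (𝕜 := ℂ) (f s)).symm
  · have : (inner ℂ f' (f t)).re = (inner ℂ (f t) f').re := inner_re_symm (𝕜 := ℂ) f' (f t)
    simp [this, two_mul]

/-- The Dirac operator is symmetric on `H¹`. -/
theorem re_inner_diracOp {u : L2 N (diracDim N)}
    (hu : MemSobolev 1 2 (u : 𝓢'(Pos N, Spin (diracDim N)))) :
    (inner ℂ u (-Complex.I • diracOp D u)).re = 0 := by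
  -- Symmetry is read off from unitarity: the derivative at 0 of the constant ‖e^{-itH}u‖² vanishes.
  have h1 := hasDerivAt_norm_sq_of_hasDerivAt (hasDerivAt_diracGroup D hu 0)
  simp only [LinearIsometry.norm_map, diracGroup_zero] at h1
  have h2 := h1.unique (hasDerivAt_const 0 (‖u‖ ^ 2))
  linarith

/-- Gronwall's inequality in both time directions; negative times are reduced to positive ones by
reflection. -/
theorem abs_le_abs_mul_exp_of_abs_deriv_le {f f' : ℝ → ℝ} {K : ℝ}
    (hf : ∀ t, HasDerivAt f (f' t) t) (hb : ∀ t, |f' t| ≤ K * |f t|) (t : ℝ) :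
    |f t| ≤ |f 0| * Real.exp (K * |t|) := by
  have key : ∀ {g g' : ℝ → ℝ}, (∀ t, HasDerivAt g (g' t) t) → (∀ t, |g' t| ≤ K * |g t|) →
      ∀ t, 0 ≤ t → |g t| ≤ |g 0| * Real.exp (K * t) := by
    intro g g' hg hb t ht
    have h := norm_le_gronwallBound_of_norm_deriv_right_le (f := g) (f' := g') (δ := |g 0|) (K := K)
      (ε := 0) (a := 0) (b := t) (fun s _ => (hg s).continuousAt.continuousWithinAt)
      (fun s _ => (hg s).hasDerivWithinAt) le_rfl (fun s _ => by simpa using hb s) t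
      (Set.right_mem_Icc.2 ht)
    rwa [gronwallBound_ε0, sub_zero] at h
  rcases le_total 0 t with ht | ht
  · rw [abs_of_nonneg ht]
    exact key hf hb t ht
  · rw [abs_of_nonpos ht]
    have h := key (g := fun s => f (-s)) (g' := fun s => -f' (-s)) (fun s => by
      simpa using! (hf (-s)).comp s (hasDerivAt_neg s)) (fun s => by simpa using hb (-s)) (-t)
      (by linarith)
    simpa using h

theorem hasDerivAt_locOp_diracGroup (n : ℕ) (z : Pos N) {u : L2 N (diracDim N)}
    (hu : MemSobolev 1 2 (u : 𝓢'(Pos N, Spin (diracDim N)))) (t : ℝ) :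
    HasDerivAt (fun s => locOp n z (diracGroup D s u))
      (-Complex.I • locOp n z (diracGroup D t (diracOp D u))) t := by
  have h := ((locOp n z : L2 N (diracDim N) →L[ℂ] _).restrictScalars ℝ).hasFDerivAt.comp_hasDerivAt
    t (hasDerivAt_diracGroup D hu t)
  convert! h using 1
  exact (map_smul (locOp n z) _ _).symm

/-- Both sides, times -i, are the derivative at s = 0 of e^{-i(s+t)H}u: once with e^{-itH}u as
initial datum, once by differentiating the orbit of u at time t. -/
theorem diracOp_diracGroup {u : L2 N (diracDim N)}
    (hu : MemSobolev 1 2 (u : 𝓢'(Pos N, Spin (diracDim N)))) (t : ℝ) :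
    diracOp D (diracGroup D t u) = diracGroup D t (diracOp D u) := by
  have h1 : HasDerivAt (fun s => diracGroup D s (diracGroup D t u))
      (-Complex.I • diracGroup D t (diracOp D u)) 0 := by
    have h := hasDerivAt_diracGroup D hu (0 + t)
    have h2 := h.comp_add_const 0 t
    simp only [diracGroup_add, zero_add] at h2
    exact h2
  have h2 := hasDerivAt_diracGroup D (memSobolev_diracGroup D t hu) 0
  rw [diracGroup_zero] at h2
  exact smul_right_injective _ (by simp : -Complex.I ≠ 0) (h2.unique h1)

/-- The exponential rate in the weighted energy estimate. -/
def energyRate (n : ℕ) : ℝ := matConst D * weightConst N n 1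

theorem norm_locOp_diracGroup_le_of_memSobolev (n : ℕ) (z : Pos N) {u : L2 N (diracDim N)}
    (hu : MemSobolev 1 2 (u : 𝓢'(Pos N, Spin (diracDim N)))) (t : ℝ) :
    ‖locOp n z (diracGroup D t u)‖ ≤ Real.exp (energyRate D n * |t|) * ‖locOp n z u‖ := by
  have hd := fun s =>
    hasDerivAt_norm_sq_of_hasDerivAt (hasDerivAt_locOp_diracGroup D n z hu s)
  -- The rate is doubled because Gronwall is applied to the square of the norm.
  have h := abs_le_abs_mul_exp_of_abs_deriv_le (K := 2 * energyRate D n) hd (fun s => ?_) t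
  · simp only [abs_pow, abs_norm, diracGroup_zero] at h
    refine (sq_le_sq₀ (norm_nonneg _) (by positivity)).1 ?_
    refine h.trans (le_of_eq ?_)
    rw [mul_pow, ← Real.exp_nat_mul, mul_comm]
    congr 2
    push_cast
    ring
  · set v := diracGroup D s u
    have hv : MemSobolev 1 2 (v : 𝓢'(Pos N, Spin (diracDim N))) := memSobolev_diracGroup D s hu
    rw [← diracOp_diracGroup D hu]
    -- Moving the weight inside H leaves a term that the symmetry of H kills and the commutator.
    have h1 : -Complex.I • locOp n z (diracOp D v) = -Complex.I • diracOp D (locOp n z v) +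
        Complex.I • (diracOp D (locOp n z v) - locOp n z (diracOp D v)) := by
      module
    rw [h1, inner_add_right, Complex.add_re, re_inner_diracOp D (memSobolev_locOp n z hv), zero_add,
      abs_mul, abs_two, abs_pow, abs_norm, mul_assoc]
    gcongr
    calc |(inner ℂ (locOp n z v) (Complex.I • (diracOp D (locOp n z v) -
            locOp n z (diracOp D v)))).re|
        ≤ ‖locOp n z v‖ * ‖Complex.I • (diracOp D (locOp n z v) - locOp n z (diracOp D v))‖ :=
          (Complex.abs_re_le_norm _).trans (norm_inner_le_norm _ _)
      _ ≤ ‖locOp n z v‖ * (energyRate D n * ‖locOp n z v‖) := by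
          gcongr
          rw [norm_smul, Complex.norm_I, one_mul]
          exact norm_diracOp_locOp_sub_le D n z hv
      _ = _ := by ring

/-- The weighted energy estimate, uniformly in the centre `z` of the weight. -/
theorem norm_locOp_diracGroup_le (n : ℕ) (z : Pos N) (u : L2 N (diracDim N)) (t : ℝ) :
    ‖locOp n z (diracGroup D t u)‖ ≤ Real.exp (energyRate D n * |t|) * ‖locOp n z u‖ := by
  refine (dense_memSobolev N (diracDim N) 1).induction (P := fun u =>
    ‖locOp n z (diracGroup D t u)‖ ≤ Real.exp (energyRate D n * |t|) * ‖locOp n z u‖)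
    (fun v hv => norm_locOp_diracGroup_le_of_memSobolev D n z hv t) ?_ u
  refine isClosed_le ?_ ?_
  · exact ((locOp n z).continuous.comp (diracGroup D t).continuous).norm
  · exact continuous_const.mul (locOp n z).continuous.norm

/-- Mean value inequality along the orbit: its velocity is -i e^{-isH}Hu, whose localised norm for
|s| ≤ |t| is given by the energy estimate. -/
theorem norm_locOp_diracGroup_sub_le (n : ℕ) (z : Pos N) {u : L2 N (diracDim N)}
    (hu : MemSobolev 1 2 (u : 𝓢'(Pos N, Spin (diracDim N)))) (t : ℝ) :
    ‖locOp n z (diracGroup D t u - u)‖ ≤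
      |t| * (Real.exp (energyRate D n * |t|) * ‖locOp n z (diracOp D u)‖) := by
  have hr : 0 ≤ energyRate D n := mul_nonneg (matConst_nonneg D) (weightConst_one_nonneg N n)
  have h := (convex_Icc (-|t|) |t|).norm_image_sub_le_of_norm_hasDerivWithin_le
    (f := fun s => locOp n z (diracGroup D s u))
    (f' := fun s => -Complex.I • locOp n z (diracGroup D s (diracOp D u)))
    (C := Real.exp (energyRate D n * |t|) * ‖locOp n z (diracOp D u)‖) (x := 0) (y := t)
    (fun s _ => (hasDerivAt_locOp_diracGroup D n z hu s).hasDerivWithinAt)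
    (fun s hs => ?_) ⟨by simp, by simp⟩ ⟨neg_abs_le t, le_abs_self t⟩
  · simpa [diracGroup_zero, mul_comm] using h
  · rw [norm_smul, norm_neg, Complex.norm_I, one_mul]
    refine (norm_locOp_diracGroup_le D n z _ s).trans ?_
    have : |s| ≤ |t| := abs_le.2 hs
    gcongr

end Energy

end

end FreeDirac

namespace FreeDirac

noncomputable section

/-! ### Sobolev embedding, plain and with weights. -/

section Sobolev

variable {N d : ℕ}

/-- When û is integrable, the inversion integral defines a continuous function bounded by ‖û‖_{L¹}.
It agrees with u almost everywhere, as testing against smooth compactly supported functions shows.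
-/
theorem norm_le_integral_norm_fourier {u : L2 N d}
    (hu : Integrable (𝓕 u : L2 N d) volume) :
    ∀ᵐ x : Pos N, ‖u x‖ ≤ ∫ ξ, ‖(𝓕 u : L2 N d) ξ‖ := by
  set G : Pos N → Spin d := 𝓕 (fun ξ => (𝓕 u : L2 N d) (-ξ)) with hG
  have hneg : Integrable (fun ξ => (𝓕 u : L2 N d) (-ξ)) volume := hu.comp_neg
  have hGb : ∀ x, ‖G x‖ ≤ ∫ ξ, ‖(𝓕 u : L2 N d) ξ‖ := fun x => by
    refine (VectorFourier.norm_fourierIntegral_le_integral_norm _ _ _ _ _).trans_eq ?_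
    exact integral_neg_eq_self (fun ξ => ‖(𝓕 u : L2 N d) ξ‖) volume
  have hGc : Continuous G := VectorFourier.fourierIntegral_continuous Real.continuous_fourierChar
    (by exact continuous_inner) hneg
  have h : u =ᵐ[volume] G := by
    refine ae_eq_of_integral_contDiff_smul_eq
      ((Lp.memLp _).locallyIntegrable one_le_two) hGc.locallyIntegrable ?_
    intro f f_smooth f_cpt
    have hf₁ : HasCompactSupport (Complex.ofRealCLM ∘ f) := f_cpt.comp_left rfl
    have hf₂ : ContDiff ℝ ((⊤ : ℕ∞) : WithTop ℕ∞) (Complex.ofRealCLM ∘ f) := by fun_prop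
    set g : 𝓢(Pos N, ℂ) := hf₁.toSchwartzMap hf₂
    have h1 : (u : 𝓢'(Pos N, Spin d)) g = ((𝓕 u : L2 N d) : 𝓢'(Pos N, Spin d)) (𝓕⁻ g) := by
      rw [← Lp.fourier_toTemperedDistribution_eq, TemperedDistribution.fourier_apply,
        FourierTransform.fourier_fourierInv_eq]
    rw [Lp.toTemperedDistribution_apply, Lp.toTemperedDistribution_apply] at h1
    have h2 : ∫ ξ, (𝓕⁻ g) ξ • (𝓕 u : L2 N d) ξ = ∫ ξ, (𝓕 (g : Pos N → ℂ)) ξ • (𝓕 u : L2 N d) (-ξ) := by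
      rw [← integral_neg_eq_self]
      refine integral_congr_ae (Filter.Eventually.of_forall fun ξ => ?_)
      simp only []
      rw [SchwartzMap.fourierInv_coe, Real.fourierInv_eq_fourier_neg, neg_neg]
    have h3 : ∫ ξ, (𝓕 (g : Pos N → ℂ)) ξ • (𝓕 u : L2 N d) (-ξ) = ∫ x, g x • G x := by
      simpa using! (VectorFourier.integral_fourierIntegral_smul_eq_flip (L := innerₗ (Pos N))
        Real.continuous_fourierChar continuous_inner g.integrable hneg)
    calc ∫ x, f x • u x = ∫ x, g x • u x := by
          refine integral_congr_ae (Filter.Eventually.of_forall fun x => ?_)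
          exact (Complex.coe_smul (f x) _).symm
      _ = ∫ x, g x • G x := by rw [h1, h2, h3]
      _ = _ := by
          refine integral_congr_ae (Filter.Eventually.of_forall fun x => ?_)
          exact Complex.coe_smul (f x) _
  filter_upwards [h] with x hx
  rw [hx]
  exact hGb x

theorem jap_natCast_le_sum {k : ℕ} (hk : k ≠ 0) (ξ : Pos N) :
    jap k ξ ≤ (N + 1 : ℝ) ^ k * (1 + ∑ l, |ξ l| ^ k) := by
  set S : ℝ := ∑ l, |ξ l| ^ k
  have hS : 0 ≤ S := by positivity
  -- T dominates 1 and every |ξₗ|, whence ⟨ξ⟩ ≤ (N + 1)T, while T^k = 1 + S.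
  set T : ℝ := (1 + S) ^ ((k : ℝ)⁻¹)
  have hTk : T ^ k = 1 + S := Real.rpow_inv_natCast_pow (by positivity) hk
  have hT0 : 0 ≤ T := by positivity
  have hT1 : 1 ≤ T := Real.one_le_rpow (by linarith) (by positivity)
  have hl : ∀ l, |ξ l| ≤ T := fun l => by
    refine (pow_le_pow_iff_left₀ (abs_nonneg _) hT0 hk).1 ?_
    rw [hTk]
    have : |ξ l| ^ k ≤ S := Finset.single_le_sum (f := fun l => |ξ l| ^ k)
      (fun _ _ => by positivity) (Finset.mem_univ l)
    linarith
  have h1 : bracket ξ ≤ (N + 1) * T := by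
    refine Real.sqrt_le_iff.2 ⟨by positivity, ?_⟩
    rw [EuclideanSpace.norm_sq_eq]
    have h2 : ∑ l, ‖ξ l‖ ^ 2 ≤ ∑ _l : Fin N, T ^ 2 := by
      gcongr with l
      exact hl l
    rw [Finset.sum_const, Finset.card_univ, Fintype.card_fin, nsmul_eq_mul] at h2
    nlinarith [sq_nonneg T, mul_nonneg (Nat.cast_nonneg (α := ℝ) N) (sq_nonneg T),
      mul_nonneg (sq_nonneg (N : ℝ)) (sq_nonneg T)]
  rw [jap_natCast, ← hTk, ← mul_pow]
  exact pow_le_pow_left₀ (Real.sqrt_nonneg _) h1 k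

theorem norm_coord_pow_le_derivSymbol (l : Fin N) (k : ℕ) (ξ : Pos N) :
    |ξ l| ^ k ≤ ‖derivSymbol (Pi.single l k) ξ‖ := by
  have h := norm_coord_le_derivSymbol l ξ
  rw [derivSymbol_single, pow_one] at h
  rw [derivSymbol_single, norm_pow]
  gcongr

/-- The Sobolev embedding `H^k ⊂ L^∞`, `k > N / 2`, in terms of the derivatives `∂ₗ^k`. -/
theorem exists_sobolev_bound (d : ℕ) {k : ℕ} (hk : (N : ℝ) / 2 < k) :
    ∃ C : ℝ, 0 ≤ C ∧ ∀ (u : L2 N d) (h : Fin N → L2 N d),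
      (∀ l, multiDeriv (Pi.single l k) (u : 𝓢'(Pos N, Spin d)) = (h l : 𝓢'(Pos N, Spin d))) →
      ∀ᵐ x : Pos N, ‖u x‖ ≤ C * (‖u‖ + ∑ l, ‖h l‖) := by
  have hk0 : k ≠ 0 := by
    rintro rfl
    have : (0 : ℝ) ≤ (N : ℝ) / 2 := by positivity
    simp only [Nat.cast_zero] at hk
    linarith
  have hjc : Continuous (jap (-k) : Pos N → ℝ) := (contDiff_jap (-k)).continuous
  have hjm : MemLp (jap (-k) : Pos N → ℝ) 2 volume := by
    refine ⟨hjc.aestronglyMeasurable, ?_⟩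
    rw [eLpNorm_lt_top_iff_lintegral_rpow_enorm_lt_top (by norm_num) (by norm_num)]
    refine lt_of_eq_of_lt (lintegral_congr fun x => ?_) (lintegral_jap_neg_lt_top hk)
    rw [Real.enorm_of_nonneg (jap_pos _ x).le]
    norm_cast
  set c : ℝ := (N + 1 : ℝ) ^ k
  refine ⟨(eLpNorm (jap (-k) : Pos N → ℝ) 2 volume).toReal * c, by positivity, fun u h hh => ?_⟩
  -- q dominates ⟨ξ⟩^k |û|, and its L² norm is bounded through Plancherel. Cauchy–Schwarz for
  -- ⟨ξ⟩^{-k} q then bounds ‖û‖_{L¹}, with ⟨ξ⟩^{-k} in L² because k > N/2.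
  set q : Pos N → ℝ := fun ξ => c * (‖(𝓕 u : L2 N d) ξ‖ + ∑ l, ‖(𝓕 (h l) : L2 N d) ξ‖)
  have hqm : AEStronglyMeasurable q volume := by
    refine AEStronglyMeasurable.const_mul ((Lp.aestronglyMeasurable _).norm.add ?_) c
    exact Finset.aestronglyMeasurable_fun_sum _ fun l _ => (Lp.aestronglyMeasurable (𝓕 (h l))).norm
  have hq : eLpNorm q 2 volume ≤ ENNReal.ofReal (c * (‖u‖ + ∑ l, ‖h l‖)) := by
    have hn : ∀ v : L2 N d, eLpNorm (fun ξ => ‖(𝓕 v : L2 N d) ξ‖) 2 volume = ENNReal.ofReal ‖v‖ :=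
      fun v => by
        rw [eLpNorm_norm, ← Lp.enorm_def, ← ofReal_norm, Lp.norm_fourier_eq]
    have hm : ∀ v : L2 N d, AEStronglyMeasurable (fun ξ => ‖(𝓕 v : L2 N d) ξ‖) volume :=
      fun v => (Lp.aestronglyMeasurable _).norm
    have hqe : q = c • ((fun ξ => ‖(𝓕 u : L2 N d) ξ‖) +
        ∑ l, fun ξ => ‖(𝓕 (h l) : L2 N d) ξ‖) := by
      funext ξ
      simp [q]
    rw [hqe, eLpNorm_const_smul, Real.enorm_of_nonneg (by positivity),
      ENNReal.ofReal_mul (by positivity)]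
    gcongr
    refine (eLpNorm_add_le (hm u) (Finset.aestronglyMeasurable_sum _ fun l _ => hm (h l))
      one_le_two).trans ?_
    rw [ENNReal.ofReal_add (norm_nonneg _) (by positivity), hn u,
      ENNReal.ofReal_sum_of_nonneg fun _ _ => norm_nonneg _]
    gcongr
    refine (eLpNorm_sum_le (fun l _ => hm (h l)) one_le_two).trans_eq ?_
    exact Finset.sum_congr rfl fun l _ => hn (h l)
  have hae : ∀ᵐ ξ : Pos N, ‖(𝓕 u : L2 N d) ξ‖ ≤ 1 * ‖((jap (-k) : Pos N → ℝ) • q) ξ‖ := by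
    have h2 : ∀ᵐ ξ : Pos N, ∀ l, (𝓕 (h l) : L2 N d) ξ =
        derivSymbol (Pi.single l k) ξ • (𝓕 u : L2 N d) ξ :=
      ae_all_iff.2 fun l => multiDeriv_eq_iff.1 (hh l)
    filter_upwards [h2] with ξ h3
    have h4 : jap k ξ * ‖(𝓕 u : L2 N d) ξ‖ ≤ q ξ := by
      refine (mul_le_mul_of_nonneg_right (jap_natCast_le_sum hk0 ξ) (norm_nonneg _)).trans ?_
      rw [mul_assoc, add_mul, one_mul, Finset.sum_mul]
      simp only [q]
      gcongr with l
      rw [h3 l, norm_smul]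
      gcongr
      exact norm_coord_pow_le_derivSymbol l k ξ
    rw [one_mul, Pi.smul_apply', norm_smul, Real.norm_of_nonneg (jap_pos _ ξ).le]
    calc ‖(𝓕 u : L2 N d) ξ‖ = jap (-k) ξ * (jap k ξ * ‖(𝓕 u : L2 N d) ξ‖) := by
          rw [← mul_assoc, ← jap_add, neg_add_cancel, jap_zero, one_mul]
      _ ≤ jap (-k) ξ * ‖q ξ‖ :=
          mul_le_mul_of_nonneg_left (h4.trans (Real.le_norm_self _)) (jap_pos _ ξ).le
  have h1 : eLpNorm (𝓕 u : L2 N d) 1 volume ≤ ENNReal.ofReal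
      ((eLpNorm (jap (-k) : Pos N → ℝ) 2 volume).toReal * c * (‖u‖ + ∑ l, ‖h l‖)) := by
    refine (eLpNorm_le_mul_eLpNorm_of_ae_le_mul hae 1).trans ?_
    rw [ENNReal.ofReal_one, one_mul, mul_assoc, ENNReal.ofReal_mul ENNReal.toReal_nonneg,
      ENNReal.ofReal_toReal hjm.2.ne]
    refine (eLpNorm_smul_le_mul_eLpNorm (p := 2) (q := 2) hqm hjc.aestronglyMeasurable).trans ?_
    gcongr
  have hint : Integrable (𝓕 u : L2 N d) volume :=
    memLp_one_iff_integrable.1 ⟨Lp.aestronglyMeasurable _, h1.trans_lt ENNReal.ofReal_lt_top⟩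
  filter_upwards [norm_le_integral_norm_fourier hint] with x hx
  refine hx.trans ?_
  rw [integral_norm_eq_lintegral_enorm (Lp.aestronglyMeasurable _), ← eLpNorm_one_eq_lintegral_enorm]
  exact ENNReal.toReal_le_of_le_ofReal (by positivity) h1

/-- One derivative of φu gives (∂φ)u + φ∂u, two products of the same kind; iterating produces the
factor 2^j. The multiplier is kept general because ∂φ replaces φ in the induction, with its sequence
of constants shifted by one. -/
theorem exists_multiDeriv_single_mulOp {n : ℕ} {z : Pos N} (l : Fin N) (A : ℝ) (j : ℕ) :
    ∀ {J : ℕ} {K : ℕ → ℝ} {φ : Pos N → ℂ} (hφ : SymbolBounded (locWeight n z) K φ)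
      (_hK : ∀ i ≤ j, K i ≤ A) {u : L2 N d} (_hu : MemSobolev (J : ℝ) 2 (u : 𝓢'(Pos N, Spin d)))
      (_hj : j ≤ J),
      ∃ h : L2 N d, multiDeriv (Pi.single l j) (mulOp φ hφ.memLp u : 𝓢'(Pos N, Spin d)) =
          (h : 𝓢'(Pos N, Spin d)) ∧
        ‖h‖ ≤ 2 ^ j * A * ∑ i ∈ Finset.range (j + 1),
          ‖locOp n z (weakDeriv (Pi.single l i) u)‖ := by
  induction j with
  | zero =>
    intro J K φ hφ hK u hu hj
    refine ⟨mulOp φ hφ.memLp u, ?_, ?_⟩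
    · rw [Pi.single_zero]
      simp [multiDeriv, List.ofFn_const]
    · rw [Finset.sum_range_one, Pi.single_zero, weakDeriv_zero_left, pow_zero, one_mul]
      exact (hφ.norm_mulOp_le u).trans (by gcongr; exact hK 0 le_rfl)
  | succ j ih =>
    intro J K φ hφ hK u hu hj
    have hu1 : MemSobolev 1 2 (u : 𝓢'(Pos N, Spin d)) := hu.mono (by exact_mod_cast (by omega))
    have hs : ∀ i : ℕ, ∑ l', (Pi.single l i : Fin N → ℕ) l' = i := fun i => by simp
    have hφ' := hφ.fderiv_apply (norm_single_one_le l)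
    obtain ⟨J, rfl⟩ : ∃ J', J = J' + 1 := ⟨J - 1, by omega⟩
    have hg : MemSobolev (J : ℝ) 2 (weakDeriv (Pi.single l 1) u : 𝓢'(Pos N, Spin d)) :=
      memSobolev_weakDeriv (J := J + 1) (by rw [hs]; omega) hu
    obtain ⟨h1, h1e, h1b⟩ := ih hφ' (fun i hi => hK (i + 1) (by omega)) hu (by omega)
    obtain ⟨h2, h2e, h2b⟩ := ih hφ (fun i hi => hK i (by omega)) hg (by omega)
    refine ⟨h1 + h2, ?_, ?_⟩
    · rw [multiDeriv_single_add, multiDeriv_single_mulOp hφ.memLp hφ.temperate hφ'.memLp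
        hφ'.temperate hu1, toTempered_add, map_add, h1e, h2e, toTempered_add]
    · have h3 : ∀ i ∈ Finset.range (j + 1),
          ‖locOp n z (weakDeriv (Pi.single l i) (weakDeriv (Pi.single l 1) u))‖ =
            ‖locOp n z (weakDeriv (Pi.single l (i + 1)) u)‖ := fun i hi => by
        have hi' := Finset.mem_range.1 hi
        rw [weakDeriv_weakDeriv (J := J + 1) (by rw [hs, hs]; omega) hu, ← Pi.single_add,
          add_comm]
      rw [Finset.sum_congr rfl h3] at h2b
      have hA : 0 ≤ A := by
        have h := (norm_nonneg _).trans (hφ.norm_le 0)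
        exact (nonneg_of_mul_nonneg_left h (locWeight_pos n z 0)).trans (hK 0 (by omega))
      set a : ℕ → ℝ := fun i => ‖locOp n z (weakDeriv (Pi.single l i) u)‖
      have ha : ∀ i, 0 ≤ a i := fun i => norm_nonneg _
      have h4 : ∑ i ∈ Finset.range (j + 1), a i ≤ ∑ i ∈ Finset.range (j + 1 + 1), a i := by
        rw [Finset.sum_range_succ _ (j + 1)]
        linarith [ha (j + 1)]
      have h5 : ∑ i ∈ Finset.range (j + 1), a (i + 1) ≤ ∑ i ∈ Finset.range (j + 1 + 1), a i := by
        rw [Finset.sum_range_succ' _ (j + 1)]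
        linarith [ha 0]
      calc ‖h1 + h2‖ ≤ ‖h1‖ + ‖h2‖ := norm_add_le _ _
        _ ≤ 2 ^ j * A * ∑ i ∈ Finset.range (j + 1 + 1), a i +
            2 ^ j * A * ∑ i ∈ Finset.range (j + 1 + 1), a i := by
          refine add_le_add (h1b.trans ?_) (h2b.trans ?_) <;> gcongr
        _ = _ := by ring

/-- A weighted Sobolev embedding in terms of uniformly local norms. -/
theorem exists_wNorm_top_le (hN : 1 ≤ N) (d n : ℕ) {k : ℕ} (hk : (N : ℝ) / 2 < k) :
    ∃ C : ℝ, 0 ≤ C ∧ ∀ (u : L2 N d) (B : ℝ), MemSobolev (k : ℝ) 2 (u : 𝓢'(Pos N, Spin d)) →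
      (∀ (z : Pos N) (l : Fin N) (i : ℕ), i ≤ k →
        ‖locOp n z (weakDeriv (Pi.single l i) u)‖ ≤ B) →
      wNorm ∞ n u ≤ ENNReal.ofReal (C * B) := by
  obtain ⟨C₁, hC₁, hsob⟩ := exists_sobolev_bound d hk
  set A : ℝ := ∑ i ∈ Finset.range (k + 1), |weightConst N n i|
  have hA0 : 0 ≤ A := by positivity
  have hA : ∀ i ≤ k, weightConst N n i ≤ A := fun i hi =>
    (le_abs_self _).trans (Finset.single_le_sum (f := fun i => |weightConst N n i|)
      (fun _ _ => abs_nonneg _) (Finset.mem_range.2 (by omega)))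
  refine ⟨2 ^ ((n : ℝ) / 2) * (C₁ * (1 + N * (2 ^ k * A * (k + 1)))), by positivity,
    fun u B hu hB => ?_⟩
  have hloc : ∀ z : Pos N, ∀ᵐ x : Pos N, locWeight n z x * ‖u x‖ ≤
      C₁ * (1 + N * (2 ^ k * A * (k + 1))) * B := fun z => by
    choose h he hb using fun l : Fin N =>
      exists_multiDeriv_single_mulOp l A k (symbolBounded_locWeight n z) hA hu le_rfl
    have hb' : ∀ l, ‖h l‖ ≤ 2 ^ k * A * ((k + 1) * B) := fun l => by
      refine (hb l).trans ?_
      gcongr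
      refine (Finset.sum_le_card_nsmul _ _ B fun i hi =>
        hB z l i (by have := Finset.mem_range.1 hi; omega)).trans_eq ?_
      simp
    have h0 : ‖locOp n z u‖ ≤ B := by
      -- The hypothesis with i = 0 in any one direction bounds u itself; a direction exists since N
      -- ≥ 1.
      have := hB z ⟨0, hN⟩ 0 (by omega)
      rwa [Pi.single_zero, weakDeriv_zero_left] at this
    filter_upwards [hsob _ h he, coeFn_locOp n z u] with x h1 h2
    change ‖(locOp n z u : L2 N d) x‖ ≤ _ at h1
    rw [h2, norm_smul, Complex.norm_real, Real.norm_of_nonneg (locWeight_pos n z x).le] at h1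
    refine h1.trans ?_
    rw [mul_assoc]
    gcongr
    calc _ ≤ B + ∑ _l : Fin N, 2 ^ k * A * ((k + 1) * B) := add_le_add h0
          (Finset.sum_le_sum fun l _ => hb' l)
      _ = _ := by
        rw [Finset.sum_const, Finset.card_univ, Fintype.card_fin, nsmul_eq_mul]
        ring
  rw [wNorm, eLpNorm_exponent_top]
  refine eLpNormEssSup_le_of_ae_bound ?_
  -- The exceptional null set depends on z, so only countably many centres are used; some centre of
  -- a dense sequence lies within 1 of x.
  filter_upwards [ae_all_iff.2 fun i => hloc (TopologicalSpace.denseSeq (Pos N) i)] with x hx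
  obtain ⟨i, hi⟩ := (TopologicalSpace.denseRange_denseSeq (Pos N)).exists_dist_lt x one_pos
  rw [dist_eq_norm] at hi
  have hb0 : 0 ≤ bracket x ^ n := pow_nonneg (Real.sqrt_nonneg _) n
  rw [norm_smul, Real.norm_of_nonneg hb0]
  calc bracket x ^ n * ‖u x‖
      ≤ 2 ^ ((n : ℝ) / 2) * locWeight n (TopologicalSpace.denseSeq (Pos N) i) x * ‖u x‖ := by
        gcongr
        exact bracket_pow_le_locWeight n hi.le
    _ ≤ 2 ^ ((n : ℝ) / 2) * (C₁ * (1 + N * (2 ^ k * A * (k + 1))) * B) := by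
        rw [mul_assoc]
        exact mul_le_mul_of_nonneg_left (hx i) (by positivity)
    _ = _ := by ring

end Sobolev

end

end FreeDirac

namespace FreeDirac

noncomputable section

/-! ### From localised norms to weighted L² norms. -/

section Tonelli

variable {N d : ℕ}

theorem enorm_locOp (n : ℕ) (z : Pos N) (f : L2 N d) :
    ‖locOp n z f‖ₑ = eLpNorm (fun x => locWeight n z x • f x) 2 volume := by
  rw [Lp.enorm_def]
  refine eLpNorm_congr_ae ?_
  filter_upwards [coeFn_locOp n z f] with x hx
  rw [hx, Complex.coe_smul]

theorem enorm_locOp_le_wNorm_two (n : ℕ) (z : Pos N) (f : L2 N d) :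
    ‖locOp n z f‖ₑ ≤ wNorm 2 n f := by
  rw [enorm_locOp, wNorm]
  refine eLpNorm_mono fun x => ?_
  rw [norm_smul, norm_smul, Real.norm_of_nonneg (locWeight_pos n z x).le,
    Real.norm_of_nonneg (show 0 ≤ bracket x ^ n from pow_nonneg (Real.sqrt_nonneg _) n)]
  gcongr
  exact locWeight_le n z x

/-- `∫ ⟨x⟩^{-2n} dx`. -/
def japMass (N n : ℕ) : ℝ≥0∞ := ∫⁻ x : Pos N, ENNReal.ofReal (jap (-n) x) ^ 2

theorem continuous_jap (r : ℝ) : Continuous (jap r : Pos N → ℝ) := (contDiff_jap r).continuous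

theorem eLpNorm_two_sq {F : Type*} [NormedAddCommGroup F] (f : Pos N → F) :
    eLpNorm f 2 volume ^ 2 = ∫⁻ x, ‖f x‖ₑ ^ 2 := by
  have := eLpNorm_nnreal_pow_eq_lintegral (f := f) (μ := (volume : Measure (Pos N)))
    (p := 2) (by norm_num)
  norm_cast at this
  exact_mod_cast this

theorem japMass_ne_zero (N n : ℕ) : japMass N n ≠ 0 := by
  have hm : Measurable fun x : Pos N => ENNReal.ofReal (jap (-n) x) ^ 2 :=
    (continuous_jap _).measurable.ennreal_ofReal.pow_const 2
  rw [japMass, Ne, lintegral_eq_zero_iff hm]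
  intro h
  obtain ⟨x, hx⟩ := h.exists
  have := jap_pos (-n) x
  simp only [Pi.zero_apply, ne_eq, OfNat.ofNat_ne_zero, not_false_eq_true, pow_eq_zero_iff,
    ENNReal.ofReal_eq_zero] at hx
  linarith

/-- Hölder for ⟨x - z⟩⁻ⁿ in L² times ⟨x⟩ⁿf in L^∞; translation invariance makes the constant
independent of z. -/
theorem enorm_locOp_sq_le_wNorm_top (n : ℕ) (z : Pos N) (f : L2 N d) :
    ‖locOp n z f‖ₑ ^ 2 ≤ japMass N n * wNorm ∞ n f ^ 2 := by
  have hm : AEStronglyMeasurable (fun x : Pos N => jap (-n) (x - z)) volume :=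
    ((continuous_jap _).comp (continuous_id.sub continuous_const)).aestronglyMeasurable
  have h1 : (fun x => locWeight n z x • f x) =
      (fun x : Pos N => jap (-n) (x - z)) • fun x => (bracket x ^ n) • f x := by
    funext x
    rw [Pi.smul_apply', smul_smul, locWeight, jap_natCast, mul_comm]
  have h2 : eLpNorm (fun x : Pos N => jap (-n) (x - z)) 2 volume ^ 2 = japMass N n := by
    rw [eLpNorm_two_sq, japMass,
      lintegral_sub_right_eq_self (fun x : Pos N => ‖jap (-n) x‖ₑ ^ 2) z]
    exact lintegral_congr fun x => by rw [Real.enorm_of_nonneg (jap_pos _ x).le]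
  rw [enorm_locOp, h1, ← h2, ← mul_pow]
  gcongr
  exact eLpNorm_smul_le_mul_eLpNorm (aesm_weighted n f) hm

theorem enorm_locOp_sq (n : ℕ) (z : Pos N) (f : L2 N d) :
    ‖locOp n z f‖ₑ ^ 2 =
      ∫⁻ x, ENNReal.ofReal (jap (-n) (x - z)) ^ 2 * ‖(bracket x ^ n) • f x‖ₑ ^ 2 := by
  rw [enorm_locOp, eLpNorm_two_sq]
  refine lintegral_congr fun x => ?_
  rw [locWeight, jap_natCast, mul_comm, ← smul_smul, enorm_smul, mul_pow,
    Real.enorm_of_nonneg (jap_pos _ _).le]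

theorem measurable_locOp_kernel (n : ℕ) (f : L2 N d) : Measurable fun p : Pos N × Pos N =>
    ENNReal.ofReal (jap (-n) (p.2 - p.1)) ^ 2 * ‖(bracket p.2 ^ n) • f p.2‖ₑ ^ 2 := by
  have hc : Continuous fun x : Pos N => bracket x ^ n := by unfold bracket; fun_prop
  have hf : Measurable fun x : Pos N => ‖(bracket x ^ n) • f x‖ₑ :=
    (hc.stronglyMeasurable.smul (Lp.stronglyMeasurable f)).enorm
  refine Measurable.mul ?_ ((hf.comp measurable_snd).pow_const 2)
  exact (((continuous_jap _).comp (continuous_snd.sub continuous_fst)).measurable.ennreal_ofReal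
    ).pow_const 2

theorem measurable_enorm_locOp_sq (n : ℕ) (f : L2 N d) :
    Measurable fun z : Pos N => ‖locOp n z f‖ₑ ^ 2 := by
  simp_rw [enorm_locOp_sq]
  exact (measurable_locOp_kernel n f).lintegral_prod_right'

/-- The weighted `L²` norm is the `L²` average of the localised norms. -/
theorem lintegral_enorm_locOp_sq (n : ℕ) (f : L2 N d) :
    ∫⁻ z : Pos N, ‖locOp n z f‖ₑ ^ 2 = japMass N n * wNorm 2 n f ^ 2 := by
  simp_rw [enorm_locOp_sq]
  rw [lintegral_lintegral_swap (measurable_locOp_kernel n f).aemeasurable]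
  have h : ∀ x : Pos N, ∫⁻ z : Pos N, ENNReal.ofReal (jap (-n) (x - z)) ^ 2 *
      ‖(bracket x ^ n) • f x‖ₑ ^ 2 = japMass N n * ‖(bracket x ^ n) • f x‖ₑ ^ 2 := fun x => by
    rw [lintegral_mul_const' _ _ (by simp), japMass,
      lintegral_sub_left_eq_self (fun x : Pos N => ENNReal.ofReal (jap (-n) x) ^ 2) x]
  simp_rw [h]
  have hm : AEMeasurable (fun x : Pos N => ‖(bracket x ^ n) • f x‖ₑ ^ 2) volume :=
    (aesm_weighted n f).enorm.pow_const 2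
  rw [lintegral_const_mul'' _ hm, wNorm, eLpNorm_two_sq]

variable (D : DiracMatrices N)

theorem energyRate_nonneg (n : ℕ) : 0 ≤ energyRate D n :=
  mul_nonneg (matConst_nonneg D) (weightConst_one_nonneg N n)

theorem enorm_locOp_diracGroup_le (n : ℕ) (z : Pos N) (u : L2 N (diracDim N)) (t : ℝ) :
    ‖locOp n z (diracGroup D t u)‖ₑ ≤
      ENNReal.ofReal (Real.exp (energyRate D n * |t|)) * ‖locOp n z u‖ₑ := by
  rw [← ofReal_norm, ← ofReal_norm, ← ENNReal.ofReal_mul (Real.exp_pos _).le]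
  exact ENNReal.ofReal_le_ofReal (norm_locOp_diracGroup_le D n z u t)

/-- The energy estimate with the weight `⟨x⟩ⁿ`. -/
theorem wNorm_two_diracGroup_le {n : ℕ} (hn : (N : ℝ) / 2 < n) (u : L2 N (diracDim N)) (t : ℝ) :
    wNorm 2 n (diracGroup D t u) ≤
      ENNReal.ofReal (Real.exp (energyRate D n * |t|)) * wNorm 2 n u := by
  have hfin : japMass N n ≠ ∞ := (lintegral_jap_neg_lt_top hn).ne
  -- The squared energy estimate is integrated over all centres z; the finite nonzero mass then
  -- cancels.
  have h : japMass N n * wNorm 2 n (diracGroup D t u) ^ 2 ≤ japMass N n *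
      (ENNReal.ofReal (Real.exp (energyRate D n * |t|)) * wNorm 2 n u) ^ 2 := by
    rw [← lintegral_enorm_locOp_sq, mul_pow, mul_left_comm, ← lintegral_enorm_locOp_sq,
      ← lintegral_const_mul' _ _ (by simp)]
    refine lintegral_mono fun z => ?_
    rw [← mul_pow]
    gcongr
    exact enorm_locOp_diracGroup_le D n z u t
  rw [ENNReal.mul_le_mul_iff_right (japMass_ne_zero N n) hfin] at h
  exact (ENNReal.pow_le_pow_left_iff two_ne_zero).1 h

/-- Strong continuity of `e^{-itH}` in the weighted `L²` norm. -/
theorem tendsto_wNorm_two_diracGroup_sub {n : ℕ} (hn : (N : ℝ) / 2 < n) {u : L2 N (diracDim N)}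
    (hu : wNorm 2 n u < ∞) :
    Filter.Tendsto (fun t => wNorm 2 n (diracGroup D t u - u)) (nhds 0) (nhds 0) := by
  have hfin : japMass N n ≠ ∞ := (lintegral_jap_neg_lt_top hn).ne
  -- For |t| < 1 the triangle inequality and the energy estimate bound the localised norm of the
  -- difference by c times that of u, whose square is integrable in z.
  set c : ℝ≥0∞ := ENNReal.ofReal (Real.exp (energyRate D n)) + 1
  have h1 : Filter.Tendsto (fun t => ∫⁻ z : Pos N, ‖locOp n z (diracGroup D t u - u)‖ₑ ^ 2)
      (nhds 0) (nhds (∫⁻ _ : Pos N, 0)) := by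
    refine tendsto_lintegral_filter_of_dominated_convergence
      (fun z => (c * ‖locOp n z u‖ₑ) ^ 2) ?_ ?_ ?_ ?_
    · exact Filter.Eventually.of_forall fun t => measurable_enorm_locOp_sq n _
    · filter_upwards [Metric.ball_mem_nhds (0 : ℝ) one_pos] with t ht
      refine Filter.Eventually.of_forall fun z => ?_
      rw [mem_ball_zero_iff, Real.norm_eq_abs] at ht
      gcongr
      rw [map_sub, add_mul, one_mul]
      refine enorm_sub_le.trans ?_
      gcongr
      refine (enorm_locOp_diracGroup_le D n z u t).trans ?_
      gcongr
      exact mul_le_of_le_one_right (energyRate_nonneg D n) ht.le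
    · simp_rw [mul_pow]
      rw [lintegral_const_mul' _ _ (by simp [c]), lintegral_enorm_locOp_sq]
      exact ENNReal.mul_ne_top (by simp [c]) (ENNReal.mul_ne_top hfin (ENNReal.pow_ne_top hu.ne))
    -- For fixed z the weight is a bounded operator, so plain L² continuity of the group suffices.
    · refine Filter.Eventually.of_forall fun z => ?_
      have h2 : Continuous fun t => ‖locOp n z (diracGroup D t u - u)‖ₑ ^ 2 :=
        (ENNReal.continuous_pow 2).comp
          ((locOp n z).continuous.comp ((continuous_diracGroup D u).sub continuous_const)).enorm
      have := h2.tendsto 0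
      simpa [diracGroup_zero] using this
  simp_rw [lintegral_enorm_locOp_sq] at h1
  rw [lintegral_zero] at h1
  have h3 := ENNReal.Tendsto.const_mul (a := (japMass N n)⁻¹) h1
    (Or.inr (ENNReal.inv_ne_top.2 (japMass_ne_zero N n)))
  have h4 : ∀ t, (japMass N n)⁻¹ * (japMass N n * wNorm 2 n (diracGroup D t u - u) ^ 2) =
      wNorm 2 n (diracGroup D t u - u) ^ 2 := fun t => by
    rw [← mul_assoc, ENNReal.inv_mul_cancel (japMass_ne_zero N n) hfin, one_mul]
  simp_rw [h4, mul_zero] at h3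
  have h5 := h3.ennrpow_const (1 / 2)
  refine (by simpa using h5 : Filter.Tendsto _ _ _).congr fun t => ?_
  rw [← ENNReal.rpow_natCast, ← ENNReal.rpow_mul]
  norm_num

end Tonelli

/-! ### The group on 𝒳_d. -/

section Assembly

variable {N k m n : ℕ}

theorem toTempered_sub {d : ℕ} (f g : L2 N d) :
    ((f - g : L2 N d) : 𝓢'(Pos N, Spin d)) = (f : 𝓢'(Pos N, Spin d)) - (g : 𝓢'(Pos N, Spin d)) :=
  map_sub (Lp.toTemperedDistributionCLM (Spin d) (volume : Measure (Pos N)) 2) f g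

theorem weakDeriv_sub {d : ℕ} {β : Fin N → ℕ} {J : ℕ} (hβ : ∑ i, β i ≤ J) {u v : L2 N d}
    (hu : MemSobolev (J : ℝ) 2 (u : 𝓢'(Pos N, Spin d)))
    (hv : MemSobolev (J : ℝ) 2 (v : 𝓢'(Pos N, Spin d))) :
    weakDeriv β (u - v) = weakDeriv β u - weakDeriv β v := by
  apply weakDeriv_eq
  rw [toTempered_sub, toTempered_sub, map_sub, multiDeriv_eq_weakDeriv hβ hu,
    multiDeriv_eq_weakDeriv hβ hv]

namespace SpaceX

variable {d : ℕ}

theorem wNorm_top_le_norm (u : SpaceX N d k m n) {β : Fin N → ℕ} (hβ : ∑ i, β i + 2 ≤ 2 * m) :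
    wNorm ∞ n (weakDeriv β u.toL2) ≤ ENNReal.ofReal ‖u‖ := by
  rw [← ENNReal.ofReal_toReal (u.toL2_mem.2.1 β hβ).ne]
  refine ENNReal.ofReal_le_ofReal ?_
  rw [norm_eq_xNorm, xNorm]
  have h1 := Finset.single_le_sum
    (f := fun β => (wNorm ∞ n (weakDeriv β u.toL2)).toReal)
    (fun _ _ => ENNReal.toReal_nonneg) (mem_multiIdx.2 (rfl : ∑ i, β i = _))
  have h2 := Finset.single_le_sum
    (f := fun j => ∑ β ∈ multiIdx N j, (wNorm ∞ n (weakDeriv β u.toL2)).toReal)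
    (fun _ _ => Finset.sum_nonneg fun _ _ => ENNReal.toReal_nonneg)
    (Finset.mem_range.2 (by omega : ∑ i, β i < 2 * m - 1))
  have h3 : 0 ≤ ∑ j ∈ Finset.Icc (2 * m - 1) (2 * m + 2 + k), ∑ β ∈ multiIdx N j,
    (wNorm 2 n (weakDeriv β u.toL2)).toReal :=
    Finset.sum_nonneg fun _ _ => Finset.sum_nonneg fun _ _ => ENNReal.toReal_nonneg
  linarith

theorem wNorm_two_le_norm (u : SpaceX N d k m n) {β : Fin N → ℕ} (hβ : 2 * m ≤ ∑ i, β i + 1)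
    (hβ' : ∑ i, β i ≤ 2 * m + 2 + k) :
    wNorm 2 n (weakDeriv β u.toL2) ≤ ENNReal.ofReal ‖u‖ := by
  rw [← ENNReal.ofReal_toReal (u.toL2_mem.2.2 β hβ hβ').ne]
  refine ENNReal.ofReal_le_ofReal ?_
  rw [norm_eq_xNorm, xNorm]
  have h1 := Finset.single_le_sum
    (f := fun β => (wNorm 2 n (weakDeriv β u.toL2)).toReal)
    (fun _ _ => ENNReal.toReal_nonneg) (mem_multiIdx.2 (rfl : ∑ i, β i = _))
  have h2 := Finset.single_le_sum
    (f := fun j => ∑ β ∈ multiIdx N j, (wNorm 2 n (weakDeriv β u.toL2)).toReal)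
    (fun _ _ => Finset.sum_nonneg fun _ _ => ENNReal.toReal_nonneg)
    (Finset.mem_Icc.2 (by omega : 2 * m - 1 ≤ ∑ i, β i ∧ ∑ i, β i ≤ 2 * m + 2 + k))
  have h3 : 0 ≤ ∑ j ∈ Finset.range (2 * m - 1), ∑ β ∈ multiIdx N j,
    (wNorm ∞ n (weakDeriv β u.toL2)).toReal :=
    Finset.sum_nonneg fun _ _ => Finset.sum_nonneg fun _ _ => ENNReal.toReal_nonneg
  linarith

/-- All derivatives of order at most `J` are uniformly locally square integrable with weight. -/
theorem norm_locOp_weakDeriv_le (hn : (N : ℝ) / 2 < n) (u : SpaceX N d k m n) {β : Fin N → ℕ}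
    (hβ : ∑ i, β i ≤ 2 * m + 2 + k) (z : Pos N) :
    ‖locOp n z (weakDeriv β u.toL2)‖ ≤ ((japMass N n).toReal + 1) * ‖u‖ := by
  have hfin : japMass N n ≠ ∞ := (lintegral_jap_neg_lt_top hn).ne
  have hM : 0 ≤ (japMass N n).toReal := ENNReal.toReal_nonneg
  -- Orders up to 2m - 2 are controlled by the sup norms, the others by the L² norms. The constant M
  -- + 1 covers both M^{1/2} and 1.
  rcases le_or_gt (∑ i, β i + 2) (2 * m) with h | h
  · refine (sq_le_sq₀ (norm_nonneg _) (by positivity)).1 ?_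
    have h1 := (enorm_locOp_sq_le_wNorm_top n z (weakDeriv β u.toL2)).trans
      (mul_le_mul_right (pow_le_pow_left₀ zero_le (u.wNorm_top_le_norm h) 2) _)
    rw [← ENNReal.ofReal_toReal hfin, ← ofReal_norm, ← ENNReal.ofReal_pow (norm_nonneg _),
      ← ENNReal.ofReal_pow (norm_nonneg _), ← ENNReal.ofReal_mul hM,
      ENNReal.ofReal_le_ofReal_iff (by positivity)] at h1
    refine h1.trans ?_
    rw [mul_pow]
    gcongr
    nlinarith
  · have h1 := (enorm_locOp_le_wNorm_two n z (weakDeriv β u.toL2)).trans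
      (u.wNorm_two_le_norm (by omega) hβ)
    rw [← ofReal_norm, ENNReal.ofReal_le_ofReal_iff (norm_nonneg _)] at h1
    refine h1.trans (le_mul_of_one_le_left (norm_nonneg _) (by linarith))

/-- The number of terms in the norm of `𝒳_d`. -/
def numTerms (N k m : ℕ) : ℕ :=
  ∑ j ∈ Finset.range (2 * m - 1), (multiIdx N j).card +
    ∑ j ∈ Finset.Icc (2 * m - 1) (2 * m + 2 + k), (multiIdx N j).card

theorem norm_le_of_forall (u : SpaceX N d k m n) {a : ℝ}
    (h1 : ∀ β : Fin N → ℕ, ∑ i, β i + 2 ≤ 2 * m → (wNorm ∞ n (weakDeriv β u.toL2)).toReal ≤ a)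
    (h2 : ∀ β : Fin N → ℕ, 2 * m ≤ ∑ i, β i + 1 → ∑ i, β i ≤ 2 * m + 2 + k →
      (wNorm 2 n (weakDeriv β u.toL2)).toReal ≤ a) : ‖u‖ ≤ numTerms N k m * a := by
  rw [norm_eq_xNorm, xNorm, numTerms]
  push_cast
  rw [add_mul, Finset.sum_mul, Finset.sum_mul]
  gcongr with j hj j hj
  · rw [← nsmul_eq_mul]
    refine Finset.sum_le_card_nsmul _ _ _ fun β hβ => h1 β ?_
    rw [mem_multiIdx] at hβ
    rw [Finset.mem_range] at hj
    omega
  · rw [← nsmul_eq_mul]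
    refine Finset.sum_le_card_nsmul _ _ _ fun β hβ => h2 β ?_ ?_
    all_goals
      rw [mem_multiIdx] at hβ
      rw [Finset.mem_Icc] at hj
      omega

end SpaceX

theorem sum_add_single (β : Fin N → ℕ) (l : Fin N) (i : ℕ) :
    ∑ j, (β + Pi.single l i : Fin N → ℕ) j = ∑ j, β j + i := by
  simp [Finset.sum_add_distrib]

variable (D : DiracMatrices N)

/-- The Sobolev embedding uses k derivatives beyond β, and 2m + 2 + k = J; the group commutes with
all of them. -/
theorem exists_wNorm_top_diracGroup_le (hN : 1 ≤ N) (hk : (N : ℝ) / 2 < k)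
    (hn : (N : ℝ) / 2 < n) (m : ℕ) :
    ∃ C : ℝ, 0 ≤ C ∧ ∀ (t : ℝ) (Ψ : SpaceX N (diracDim N) k m n) (β : Fin N → ℕ),
      ∑ i, β i ≤ 2 * m + 2 → wNorm ∞ n (weakDeriv β (diracGroup D t Ψ.toL2)) ≤
        ENNReal.ofReal (C * (Real.exp (energyRate D n * |t|) * ‖Ψ‖)) := by
  obtain ⟨C, hC, h⟩ := exists_wNorm_top_le hN (diracDim N) n hk
  refine ⟨C * ((japMass N n).toReal + 1), by positivity, fun t Ψ β hβ => ?_⟩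
  have hΨ := Ψ.toL2_mem.1
  have hG := memSobolev_diracGroup D t hΨ
  rw [mul_assoc]
  refine h _ _ (memSobolev_weakDeriv (by omega) hG) fun z l i hi => ?_
  rw [weakDeriv_weakDeriv (by simp; omega) hG,
    weakDeriv_diracGroup D t (by rw [sum_add_single]; omega) hΨ]
  refine (norm_locOp_diracGroup_le D n z _ t).trans ?_
  rw [mul_left_comm]
  gcongr
  exact Ψ.norm_locOp_weakDeriv_le hn (by rw [sum_add_single]; omega) z

/-- The embedding uses k derivatives beyond β and the factor |t| costs one more through H, so the
total order is at most 2m + k + 1 < J. -/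
theorem exists_wNorm_top_diracGroup_sub_le (hN : 1 ≤ N) (hk : (N : ℝ) / 2 < k)
    (hn : (N : ℝ) / 2 < n) (m : ℕ) :
    ∃ C : ℝ, 0 ≤ C ∧ ∀ (t : ℝ) (Ψ : SpaceX N (diracDim N) k m n) (β : Fin N → ℕ),
      ∑ i, β i ≤ 2 * m → wNorm ∞ n (weakDeriv β (diracGroup D t Ψ.toL2 - Ψ.toL2)) ≤
        ENNReal.ofReal (C * (|t| * (Real.exp (energyRate D n * |t|) * ‖Ψ‖))) := by
  obtain ⟨C, hC, h⟩ := exists_wNorm_top_le hN (diracDim N) n hk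
  set c : ℝ := (japMass N n).toReal + 1
  have hc : 0 ≤ c := by positivity
  have hmat := matConst_nonneg D
  refine ⟨C * (matConst D * ((N + 1) * c)), by positivity, fun t Ψ β hβ => ?_⟩
  have hΨ := Ψ.toL2_mem.1
  have hG := memSobolev_diracGroup D t hΨ
  have hs : MemSobolev ((2 * m + 2 + k : ℕ) : ℝ) 2
      ((diracGroup D t Ψ.toL2 - Ψ.toL2 : L2 N _) : 𝓢'(Pos N, Spin (diracDim N))) := by
    rw [toTempered_sub]
    exact hG.sub hΨ
  rw [mul_assoc]
  refine h _ _ (memSobolev_weakDeriv (by omega) hs) fun z l i hi => ?_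
  have hord : ∑ j, (β + Pi.single l i : Fin N → ℕ) j + 1 ≤ 2 * m + 2 + k := by
    rw [sum_add_single]
    omega
  rw [weakDeriv_weakDeriv (by simp; omega) hs, weakDeriv_sub (by omega) hG hΨ,
    weakDeriv_diracGroup D t (by omega) hΨ]
  set γ : Fin N → ℕ := β + Pi.single l i
  have hγ : MemSobolev 1 2
      (weakDeriv γ Ψ.toL2 : 𝓢'(Pos N, Spin (diracDim N))) := by
    exact_mod_cast memSobolev_weakDeriv (r := 1) hord hΨ
  refine (norm_locOp_diracGroup_sub_le D n z hγ t).trans ?_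
  calc |t| * (Real.exp (energyRate D n * |t|) * ‖locOp n z (diracOp D (weakDeriv γ Ψ.toL2))‖)
      ≤ |t| * (Real.exp (energyRate D n * |t|) *
          (matConst D * (∑ _l : Fin N, c * ‖Ψ‖ + c * ‖Ψ‖))) := by
        gcongr
        refine (norm_locOp_diracOp_le D n z _).trans ?_
        gcongr with l'
        · rw [weakDeriv_weakDeriv (J := 2 * m + 2 + k) (by simpa using hord) hΨ]
          exact Ψ.norm_locOp_weakDeriv_le hn (by rw [sum_add_single]; exact hord) z
        · exact Ψ.norm_locOp_weakDeriv_le hn (by omega) z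
    _ = _ := by
        rw [Finset.sum_const, Finset.card_univ, Fintype.card_fin, nsmul_eq_mul]
        ring

theorem diracGroup_mem_spaceX (hN : 1 ≤ N) (hk : (N : ℝ) / 2 < k) (hn : (N : ℝ) / 2 < n) (t : ℝ)
    (Ψ : SpaceX N (diracDim N) k m n) :
    diracGroup D t Ψ.toL2 ∈ spaceXSubmodule N (diracDim N) k m n := by
  obtain ⟨C, -, h⟩ := exists_wNorm_top_diracGroup_le D hN hk hn m
  refine ⟨memSobolev_diracGroup D t Ψ.toL2_mem.1, fun β hβ => ?_, fun β hβ hβ' => ?_⟩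
  · exact (h t Ψ β (by omega)).trans_lt ENNReal.ofReal_lt_top
  · rw [weakDeriv_diracGroup D t hβ' Ψ.toL2_mem.1]
    exact (wNorm_two_diracGroup_le D hn _ t).trans_lt
      (ENNReal.mul_lt_top ENNReal.ofReal_lt_top (Ψ.toL2_mem.2.2 β hβ hβ'))

/-- The free Dirac group on `𝒳_d`. -/
def diracGroupX (hN : 1 ≤ N) (hk : (N : ℝ) / 2 < k) (hn : (N : ℝ) / 2 < n) (t : ℝ)
    (Ψ : SpaceX N (diracDim N) k m n) : SpaceX N (diracDim N) k m n :=
  (⟨diracGroup D t Ψ.toL2, diracGroup_mem_spaceX D hN hk hn t Ψ⟩ :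
    spaceXSubmodule N (diracDim N) k m n)

theorem toL2_diracGroupX (hN : 1 ≤ N) (hk : (N : ℝ) / 2 < k) (hn : (N : ℝ) / 2 < n) (t : ℝ)
    (Ψ : SpaceX N (diracDim N) k m n) :
    (diracGroupX D hN hk hn t Ψ).toL2 = diracGroup D t Ψ.toL2 := rfl

theorem tendsto_diracGroupX_sub (hN : 1 ≤ N) (hk : (N : ℝ) / 2 < k) (hn : (N : ℝ) / 2 < n)
    (Ψ : SpaceX N (diracDim N) k m n) :
    Filter.Tendsto (fun t => ‖diracGroupX D hN hk hn t Ψ - Ψ‖) (nhds 0) (nhds 0) := by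
  obtain ⟨C, hC, h⟩ := exists_wNorm_top_diracGroup_sub_le D hN hk hn m
  have hlow : ∀ j ∈ Finset.range (2 * m - 1), ∀ β ∈ multiIdx N j,
      Filter.Tendsto (fun t => (wNorm ∞ n (weakDeriv β
        (diracGroupX D hN hk hn t Ψ - Ψ).toL2)).toReal) (nhds 0) (nhds 0) := by
    intro j hj β hβ
    rw [Finset.mem_range] at hj
    rw [mem_multiIdx] at hβ
    have hc : Continuous fun t : ℝ => C * (|t| * (Real.exp (energyRate D n * |t|) * ‖Ψ‖)) := by
      fun_prop
    have h0 := hc.tendsto 0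
    simp only [abs_zero, zero_mul, mul_zero] at h0
    refine squeeze_zero (fun _ => ENNReal.toReal_nonneg) (fun t => ?_) h0
    refine ENNReal.toReal_le_of_le_ofReal (by positivity) ?_
    rw [map_sub, toL2_diracGroupX]
    exact h t Ψ β (by omega)
  have hhigh : ∀ j ∈ Finset.Icc (2 * m - 1) (2 * m + 2 + k), ∀ β ∈ multiIdx N j,
      Filter.Tendsto (fun t => (wNorm 2 n (weakDeriv β
        (diracGroupX D hN hk hn t Ψ - Ψ).toL2)).toReal) (nhds 0) (nhds 0) := by
    intro j hj β hβ
    rw [Finset.mem_Icc] at hj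
    rw [mem_multiIdx] at hβ
    have hΨ := Ψ.toL2_mem.1
    have h1 : ∀ t, weakDeriv β (diracGroupX D hN hk hn t Ψ - Ψ).toL2 =
        diracGroup D t (weakDeriv β Ψ.toL2) - weakDeriv β Ψ.toL2 := fun t => by
      rw [map_sub, toL2_diracGroupX, weakDeriv_sub (by omega) (memSobolev_diracGroup D t hΨ) hΨ,
        weakDeriv_diracGroup D t (by omega) hΨ]
    simp_rw [h1]
    have h2 := tendsto_wNorm_two_diracGroup_sub D hn (Ψ.toL2_mem.2.2 β (by omega) (by omega))
    simpa using! (ENNReal.tendsto_toReal ENNReal.zero_ne_top).comp h2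
  have h3 := (tendsto_finsetSum _ fun j hj => tendsto_finsetSum _ (hlow j hj)).add
    (tendsto_finsetSum _ fun j hj => tendsto_finsetSum _ (hhigh j hj))
  simpa using! h3

theorem continuous_diracGroupX (hN : 1 ≤ N) (hk : (N : ℝ) / 2 < k) (hn : (N : ℝ) / 2 < n)
    (Ψ : SpaceX N (diracDim N) k m n) :
    Continuous fun t => diracGroupX D hN hk hn t Ψ := by
  refine continuous_iff_continuousAt.2 fun s => tendsto_iff_norm_sub_tendsto_zero.2 ?_
  have h1 := tendsto_diracGroupX_sub D hN hk hn (diracGroupX D hN hk hn s Ψ)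
  have h2 : Filter.Tendsto (fun t : ℝ => t - s) (nhds s) (nhds 0) := by
    have : Continuous fun t : ℝ => t - s := by fun_prop
    simpa using this.tendsto s
  refine (h1.comp h2).congr fun t => ?_
  -- The group law reduces continuity at s to continuity at 0 for the datum e^{-isH}Ψ.
  have h3 : diracGroupX D hN hk hn (t - s) (diracGroupX D hN hk hn s Ψ) =
      diracGroupX D hN hk hn t Ψ := by
    apply SpaceX.toL2_injective
    rw [toL2_diracGroupX, toL2_diracGroupX, toL2_diracGroupX, ← diracGroup_add, sub_add_cancel]
  rw [Function.comp_apply, h3]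

theorem exists_norm_diracGroupX_le (hN : 1 ≤ N) (hk : (N : ℝ) / 2 < k) (hn : (N : ℝ) / 2 < n)
    (m : ℕ) :
    ∃ C : ℝ, 0 ≤ C ∧ ∀ (t : ℝ) (Ψ : SpaceX N (diracDim N) k m n),
      ‖diracGroupX D hN hk hn t Ψ‖ ≤ C * (Real.exp (energyRate D n * |t|) * ‖Ψ‖) := by
  obtain ⟨C, hC, h⟩ := exists_wNorm_top_diracGroup_le D hN hk hn m
  -- Each summand of the norm is bounded with the constant C (sup norms) or 1 (L² norms).
  refine ⟨SpaceX.numTerms N k m * (C + 1), by positivity, fun t Ψ => ?_⟩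
  set a : ℝ := Real.exp (energyRate D n * |t|) * ‖Ψ‖ with ha
  have ha0 : 0 ≤ a := by positivity
  rw [mul_assoc]
  refine SpaceX.norm_le_of_forall _ (fun β hβ => ?_) fun β hβ hβ' => ?_
  · refine ENNReal.toReal_le_of_le_ofReal (by positivity) ((h t Ψ β (by omega)).trans ?_)
    exact ENNReal.ofReal_le_ofReal (by linarith)
  · refine ENNReal.toReal_le_of_le_ofReal (by positivity) ?_
    rw [toL2_diracGroupX, weakDeriv_diracGroup D t hβ' Ψ.toL2_mem.1]
    refine (wNorm_two_diracGroup_le D hn _ t).trans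
      ((mul_le_mul_right (Ψ.wNorm_two_le_norm hβ hβ') _).trans ?_)
    rw [← ENNReal.ofReal_mul (Real.exp_pos _).le]
    exact ENNReal.ofReal_le_ofReal (by rw [← ha]; nlinarith)

end Assembly

end

end FreeDirac

/-! ### The main theorem. -/

theorem mainTheorem6 (N k m n : ℕ) (hN : 1 ≤ N) (hk : (N : ℝ) / 2 < k)
    (hn : (N : ℝ) / 2 + 1 < n) (hm : k + n + 3 ≤ 2 * m) (D : DiracMatrices N) :
    ∃ U : ℝ → SpaceX N (diracDim N) k m n → SpaceX N (diracDim N) k m n,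
      (∀ t Ψ, (U t Ψ).toL2 = diracGroup D t Ψ.toL2) ∧
      (∀ Ψ, Continuous fun t : ℝ => U t Ψ) ∧
      ∃ C : ℝ, 0 < C ∧ ∃ t₀ : ℝ, 0 < t₀ ∧
        ∀ t : ℝ, |t| ≤ t₀ → ∀ Ψ : SpaceX N (diracDim N) k m n,
          ‖U t Ψ‖ ≤ C * (1 + |t|) ^ (2 * m + n + 1) * ‖Ψ‖ ∧
          (⨆ (β : Fin N → ℕ) (_ : ∑ i, β i ≤ 2 * m),
              wNorm ∞ n (weakDeriv β (diracGroup D t Ψ.toL2 - Ψ.toL2))) ≤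
            ENNReal.ofReal (C * |t| * (1 + |t|) ^ (2 * m + n + 1) * ‖Ψ‖) := by
  have hn' : (N : ℝ) / 2 < n := by linarith
  obtain ⟨C₁, hC₁, h1⟩ := exists_norm_diracGroupX_le D hN hk hn' m
  obtain ⟨C₂, hC₂, h2⟩ := exists_wNorm_top_diracGroup_sub_le D hN hk hn' m
  have hr := energyRate_nonneg D n
  have hexp : ∀ t : ℝ, |t| ≤ 1 →
      Real.exp (energyRate D n * |t|) ≤ Real.exp (energyRate D n) := fun t ht =>
    Real.exp_le_exp.2 (mul_le_of_le_one_right hr ht)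
  have hpow : ∀ t : ℝ, 1 ≤ (1 + |t|) ^ (2 * m + n + 1) := fun t =>
    one_le_pow₀ (by linarith [abs_nonneg t])
  set e : ℝ := Real.exp (energyRate D n)
  have he : 0 < e := Real.exp_pos _
  -- With t₀ = 1 the exponential is at most e, which is absorbed in C; the polynomial factor is
  -- inserted because it is at least 1. The summand 1 in C ensures C > 0.
  refine ⟨diracGroupX D hN hk hn', toL2_diracGroupX D hN hk hn', continuous_diracGroupX D hN hk hn',
    (C₁ + C₂ + 1) * e, by positivity, 1, one_pos, fun t ht Ψ => ⟨?_, iSup₂_le fun β hβ => ?_⟩⟩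
  · calc ‖diracGroupX D hN hk hn' t Ψ‖ ≤ C₁ * (Real.exp (energyRate D n * |t|) * ‖Ψ‖) := h1 t Ψ
      _ ≤ (C₁ + C₂ + 1) * (e * ‖Ψ‖) := by
          gcongr
          · linarith
          · exact hexp t ht
      _ = (C₁ + C₂ + 1) * e * 1 * ‖Ψ‖ := by ring
      _ ≤ _ := by
          gcongr
          exact hpow t
  · refine (h2 t Ψ β hβ).trans (ENNReal.ofReal_le_ofReal ?_)
    calc C₂ * (|t| * (Real.exp (energyRate D n * |t|) * ‖Ψ‖))
        ≤ (C₁ + C₂ + 1) * (|t| * (e * ‖Ψ‖)) := by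
          gcongr
          · linarith
          · exact hexp t ht
      _ = (C₁ + C₂ + 1) * e * |t| * 1 * ‖Ψ‖ := by ring
      _ ≤ _ := by
          gcongr
          exact hpow t
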